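/- Let $\mathcal M$ be a finite-dimensional smooth Riemannian manifold without boundary that is geodesically complete, so that $\mathrm{Exp}_x$ is defined on all of $T_x\mathcal M$ for every $x$. Let $\mathcal D$ be a probability distribution, let $f(\cdot,\xi):\mathcal M\to\mathbb R$ be functions indexed by the samples $\xi$, integrable in $\xi\sim\mathcal D$, and let $f(x)=\mathbb E_{\xi\sim\mathcal D}[f(x,\xi)]$ be differentiable; $\nabla$ denotes the Riemannian gradient in $x$. Assume: (i) (unbiasedness) $\mathbb E_{\xi\sim\mathcal D}[\nabla f(x,\xi)]=\nabla f(x)$ for all $x\in\mathcal M$; (ii) (bounded variance) for some $\sigma\ge 0$, $\mathbb E_{\xi\sim\mathcal D}\|\nabla f(x,\xi)-\nabla f(x)\|^2\le\sigma^2$ for all $x\in\mathcal M$; (iii) (geodesic $L$-smoothness, $L>0$) for every $\xi$, the function $f(\cdot,\xi)$ is differentiable and, for every geodesic $\gamma:[0,1]\to\mathcal M$ with $\gamma(0)=x$, $\gamma(1)=y$, $\|\nabla f(x,\xi)-\Gamma_y^x\nabla f(y,\xi)\|\le L\|\dot\gamma(0)\|$, where $\Gamma_y^x$ is the parallel transport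 (of the Levi-Civita connection) along $\gamma$ from $y$ to $x$; (iv) (lower bound) $f^*\in\mathbb R$ satisfies $f(x)\ge f^*$ for all $x\in\mathcal M$. For a batch of $n$ independent samples $\xi_1,\dots,\xi_n\sim\mathcal D$ write $\nabla f_n(x)=\frac1n\sum_{i=1}^n\nabla f(x,\xi_i)$. Given $x^0\in\mathcal M$, a stepsize $\eta>0$, batch sizes $B,b\ge 1$ and $p\in(0,1]$, R-PAGE sets $g^0=\nabla f_B(x^0)$ and, for $k=0,1,2,\dots$, $x^{k+1}=\mathrm{Exp}_{x^k}(-\eta g^k)$ and $$g^{k+1}=\begin{cases}\nabla f_B(x^{k+1}) & \text{with probability } p,\\ \Gamma_{x^k}^{x^{k+1}}g^k+\nabla f_b(x^{k+1})-\Gamma_{x^k}^{x^{k+1}}\nabla f_b(x^k) & \text{with probability } 1-p,\end{cases}$$ where $\Gamma_{x^k}^{x^{k+1}}$ is the parallel transport along the geodesic $t\mapsto\mathrm{Exp}_{x^k}(-t\eta g^k)$, $0\le t\le1$, the two gradients $\nabla f_b$ use the same batch, and the batches and coins of all the iterations are drawn afresh and independently. If $$\eta\le\frac{1}{L\left(1+\sqrt{\frac{1-p}{pb}}\right)},$$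 then for every $K\ge 1$ $$\mathbb E\|\nabla f(\widehat x^K)\|^2\le\frac{2\,\mathbb E[\Phi^0]}{\eta K}+\frac{\sigma^2}{B},\qquad \Phi^0=f(x^0)-f^*+\frac{\eta\sigma^2}{2pB},$$ where $\widehat x^K$ is chosen uniformly at random from $x^0,\dots,x^{K-1}$, independently of everything else. (As $x^0$ is deterministic, $\mathbb E[\Phi^0]=\Phi^0$.) -/

import Mathlib

open MeasureTheory ProbabilityTheory Bundle
open scoped Manifold ContDiff

noncomputable section

namespace RPage

section Geometry

variable {E : Type*} [NormedAddCommGroup E] [NormedSpace ℝ E]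
  {M : Type*} [TopologicalSpace M] [ChartedSpace E M] [IsManifold 𝓘(ℝ, E) ∞ M]

/-- The velocity `γ'(t) ∈ T_{γ(t)} M` of a curve in `M`. -/
def velocity (γ : ℝ → M) (t : ℝ) : TangentSpace 𝓘(ℝ, E) (γ t) :=
  mfderiv 𝓘(ℝ, ℝ) 𝓘(ℝ, E) γ t (1 : ℝ)

/-- The coordinate vector field (constant in the preferred chart at `x`, defined near `x`) that
takes the value `v` at `x`. -/
def coordField (x : M) (v : TangentSpace 𝓘(ℝ, E) x) (p : M) : TangentSpace 𝓘(ℝ, E) p :=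
  (trivializationAt E (TangentSpace 𝓘(ℝ, E)) x).symm p
    (trivializationAt E (TangentSpace 𝓘(ℝ, E)) x ⟨x, v⟩).2

/-- The components, in the preferred chart at `γ t₀`, of a vector field `V` along `γ`. -/
def coordAlong (γ : ℝ → M) (V : ∀ t, TangentSpace 𝓘(ℝ, E) (γ t)) (t₀ t : ℝ) : E :=
  (trivializationAt E (TangentSpace 𝓘(ℝ, E)) (γ t₀) ⟨γ t, V t⟩).2

variable [RiemannianBundle (fun x : M ↦ TangentSpace 𝓘(ℝ, E) x)]

/-- The derivative at `x`, in the direction `u`, of the metric coefficient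
`p ↦ ⟨v, w⟩_p` of the preferred chart at `x`. -/
def metricDeriv (x : M) (u v w : TangentSpace 𝓘(ℝ, E) x) : ℝ :=
  mfderiv 𝓘(ℝ, E) 𝓘(ℝ, ℝ)
    (fun p : M ↦ (inner ℝ (coordField x v p) (coordField x w p) : ℝ)) x u

/-- Christoffel symbols of the first kind of the Levi-Civita connection, in the preferred chart at
`x` and at the point `x`: the number `⟨∇_u v, w⟩` for coordinate fields, given by
`(∂_u g(v, w) + ∂_v g(u, w) - ∂_w g(u, v)) / 2`. -/
def christoffel (x : M) (u v w : TangentSpace 𝓘(ℝ, E) x) : ℝ :=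
  (metricDeriv x u v w + metricDeriv x v u w - metricDeriv x w u v) / 2

/-- `V` is parallel along `γ` for the Levi-Civita connection: at each time `t`, in the chart at
`γ t`, the covariant derivative `V' + Γ(γ', V)` vanishes (tested against every vector `w`). -/
def IsParallelAlong (γ : ℝ → M) (V : ∀ t, TangentSpace 𝓘(ℝ, E) (γ t)) : Prop :=
  ∀ t : ℝ, DifferentiableAt ℝ (coordAlong γ V t) t ∧
    ∀ w : TangentSpace 𝓘(ℝ, E) (γ t),
      inner ℝ ((trivializationAt E (TangentSpace 𝓘(ℝ, E)) (γ t)).symm (γ t)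
          (deriv (coordAlong γ V t) t)) w
        + christoffel (γ t) (velocity γ t) (V t) w = 0

/-- A geodesic `ℝ → M`: a smooth curve whose velocity is parallel along it. -/
def IsGeodesic (γ : ℝ → M) : Prop :=
  ContMDiff 𝓘(ℝ, ℝ) 𝓘(ℝ, E) ∞ γ ∧ IsParallelAlong γ (velocity (E := E) γ)

/-- `γ` is a geodesic with `γ(0) = x` and `γ'(0) = v`. -/
def IsGeodesicFrom (x : M) (v : TangentSpace 𝓘(ℝ, E) x) (γ : ℝ → M) : Prop :=
  IsGeodesic (E := E) γ ∧ (⟨γ 0, velocity γ 0⟩ : TangentBundle 𝓘(ℝ, E) M) = ⟨x, v⟩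

variable (E M) in
/-- Geodesic completeness: the exponential map is defined on the whole tangent bundle. -/
def GeodesicallyComplete : Prop :=
  ∀ (x : M) (v : TangentSpace 𝓘(ℝ, E) x), ∃ γ : ℝ → M, IsGeodesicFrom x v γ

open Classical in
/-- The geodesic with initial point `x` and initial velocity `v`
(a junk value if there is none). -/
def geodesic (x : M) (v : TangentSpace 𝓘(ℝ, E) x) : ℝ → M :=
  if h : ∃ γ : ℝ → M, IsGeodesicFrom x v γ then h.choose else fun _ ↦ x

/-- The exponential map `Exp_x(v)`. -/
def expMap (x : M) (v : TangentSpace 𝓘(ℝ, E) x) : M := geodesic x v 1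

/-- The tangent vector `w` is the parallel transport of `u` along `γ` from time `a` to time `b`. -/
def IsParallelTransport (γ : ℝ → M) (a b : ℝ) (u w : TangentBundle 𝓘(ℝ, E) M) : Prop :=
  ∃ V : ∀ t, TangentSpace 𝓘(ℝ, E) (γ t), IsParallelAlong γ V ∧
    (⟨γ a, V a⟩ : TangentBundle 𝓘(ℝ, E) M) = u ∧ (⟨γ b, V b⟩ : TangentBundle 𝓘(ℝ, E) M) = w

open Classical in
/-- The parallel transport `Γ_x^y u ∈ T_y M` of `u ∈ T_x M` to `y = Exp_x(v)`, along the geodesic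
`t ↦ Exp_x(t v)`, `0 ≤ t ≤ 1`. -/
def expTransport (x : M) (v u : TangentSpace 𝓘(ℝ, E) x) : TangentSpace 𝓘(ℝ, E) (expMap x v) :=
  if h : ∃ w : TangentSpace 𝓘(ℝ, E) (expMap x v),
      IsParallelTransport (geodesic x v) 0 1 ⟨x, u⟩ ⟨expMap x v, w⟩
  then h.choose else 0

variable [FiniteDimensional ℝ E]

/-- The Riemannian gradient: `⟨∇f(x), v⟩ = df_x(v)` for all `v ∈ T_x M`. -/
def grad (f : M → ℝ) (x : M) : TangentSpace 𝓘(ℝ, E) x :=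
  haveI : FiniteDimensional ℝ (TangentSpace 𝓘(ℝ, E) x) := inferInstanceAs (FiniteDimensional ℝ E)
  haveI : CompleteSpace (TangentSpace 𝓘(ℝ, E) x) := FiniteDimensional.complete ℝ _
  (InnerProductSpace.toDual ℝ (TangentSpace 𝓘(ℝ, E) x)).symm (mfderiv 𝓘(ℝ, E) 𝓘(ℝ, ℝ) f x)

variable (E) in
/-- Geodesic `L`-smoothness: `f` is differentiable and `‖∇f(x) - Γ_y^x ∇f(y)‖ ≤ L ‖v‖` for every
geodesic `γ : [0, 1] → M` from `x` to `y` with initial velocity `v`, where `Γ_y^x` is the parallel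
transport along `γ`. -/
def GeodesicallySmooth (L : ℝ) (f : M → ℝ) : Prop :=
  MDifferentiable 𝓘(ℝ, E) 𝓘(ℝ, ℝ) f ∧
    ∀ γ : ℝ → M, IsGeodesic (E := E) γ → ∀ w : TangentSpace 𝓘(ℝ, E) (γ 0),
      IsParallelTransport γ 1 0 ⟨γ 1, grad f (γ 1)⟩ ⟨γ 0, w⟩ →
        ‖grad f (γ 0) - w‖ ≤ L * ‖velocity (E := E) γ 0‖

end Geometry

section Algorithm

/-- The fresh randomness of one iteration: a batch of size `B`, a batch of size `b`, a coin. -/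
abbrev Sample (Ξ : Type*) (B b : ℕ) : Type _ := (Fin B → Ξ) × (Fin b → Ξ) × Bool

/-- The law of a sample: i.i.d. draws from `D`, and an independent coin that
shows `true` with probability `p`. -/
def sampleLaw {Ξ : Type*} [MeasurableSpace Ξ] (D : Measure Ξ) (B b : ℕ)
    (p : unitInterval) : Measure (Sample Ξ B b) :=
  (Measure.pi fun _ : Fin B ↦ D).prod ((Measure.pi fun _ : Fin b ↦ D).prod (bernoulliMeasure true false p))

/-- The objective of the online problem, `f(x) = 𝔼_{ξ ∼ D} f(x, ξ)`. -/
def objective {M Ξ : Type*} [MeasurableSpace Ξ] (D : Measure Ξ) (F : M → Ξ → ℝ) (x : M) : ℝ :=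
  ∫ ξ, F x ξ ∂D

variable {E : Type*} [NormedAddCommGroup E] [NormedSpace ℝ E] [FiniteDimensional ℝ E]
  {M : Type*} [TopologicalSpace M] [ChartedSpace E M] [IsManifold 𝓘(ℝ, E) ∞ M]
  [RiemannianBundle (fun x : M ↦ TangentSpace 𝓘(ℝ, E) x)]
  {Ξ : Type*}

/-- The stochastic gradient `∇f(x, ξ)`, the gradient being taken in `x`. -/
def stochGrad (F : M → Ξ → ℝ) (x : M) (ξ : Ξ) : TangentSpace 𝓘(ℝ, E) x :=
  grad (fun y ↦ F y ξ) x

/-- The minibatch gradient `(1/n) ∑ᵢ ∇f(x, ξᵢ)`. -/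
def batchGrad (F : M → Ξ → ℝ) {n : ℕ} (ξ : Fin n → Ξ) (x : M) : TangentSpace 𝓘(ℝ, E) x :=
  (1 / n : ℝ) • ∑ i, stochGrad F x (ξ i)

/-- One iteration of R-PAGE, from `(xᵏ, gᵏ)` to `(xᵏ⁺¹, gᵏ⁺¹)`. -/
def pageStep (F : M → Ξ → ℝ) (η : ℝ) {B b : ℕ} (z : TangentBundle 𝓘(ℝ, E) M)
    (s : Sample Ξ B b) : TangentBundle 𝓘(ℝ, E) M :=
  let x : M := z.1
  let g : TangentSpace 𝓘(ℝ, E) x := z.2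
  let v : TangentSpace 𝓘(ℝ, E) x := -(η • g)
  let y : M := expMap x v
  if s.2.2 then ⟨y, batchGrad F s.1 y⟩
  else ⟨y, expTransport x v g + batchGrad F s.2.1 y - expTransport x v (batchGrad F s.2.1 x)⟩

variable (E) in
/-- The pair `(xᵏ, gᵏ)` of R-PAGE started at `x₀` with step size `η`, as a function of the samples:
`g⁰` is the batch gradient of sample `0`, and step `k → k + 1` uses sample `k + 1`. -/
def pageState (F : M → Ξ → ℝ) (η : ℝ) (x₀ : M) {B b : ℕ} (s : ℕ → Sample Ξ B b) :
    ℕ → TangentBundle 𝓘(ℝ, E) M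
  | 0 => ⟨x₀, batchGrad F (s 0).1 x₀⟩
  | k + 1 => pageStep F η (pageState F η x₀ s k) (s (k + 1))

end Algorithm

end RPage

end

/-!
Parallel transport for the Levi-Civita connection is a linear isometry. Integrating geodesic
smoothness along a geodesic therefore yields the descent inequality
`f (Exp_x v) ≤ f x + ⟪∇f x, v⟫ + L ‖v‖ ^ 2 / 2`, and by unbiasedness the objective inherits the
smoothness of the samples. With `v = -η g` the descent inequality contains the error
`e = ‖g - ∇f x‖ ^ 2` of the gradient estimator. Since the batches are fresh and the samples smooth,
conditionally on the past this error satisfies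
`𝔼 eₖ₊₁ ≤ p σ² / B + (1 - p) (eₖ + (L η ‖gₖ‖) ^ 2 / b)`. The step-size bound is what lets the
descent term absorb the last summand, so that the potential `(2 / η) (f x - f*) + e / p` decreases
on average by `‖∇f x‖ ^ 2`, up to `σ² / B`; the sum over the iterates telescopes.
-/

noncomputable section

namespace RPage

section BilinearForms

variable {E : Type*} [NormedAddCommGroup E] [NormedSpace ℝ E]

-- Without these instances, instance search times out on spaces of bilinear and trilinear forms.
instance : NormedAddCommGroup (E →L[ℝ] E →L[ℝ] ℝ) := ContinuousLinearMap.toNormedAddCommGroup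

instance : NormedSpace ℝ (E →L[ℝ] E →L[ℝ] ℝ) := ContinuousLinearMap.toNormedSpace

end BilinearForms

section LinearODE

open Set Metric Topology
open scoped NNReal

variable {E : Type*} [NormedAddCommGroup E] [NormedSpace ℝ E] {A : ℝ → E →L[ℝ] E}

theorem isPicardLindelof_linear {tmin tmax : ℝ} {C : ℝ≥0} (hA : ContinuousOn A (Icc tmin tmax))
    (hC : ∀ t ∈ Icc tmin tmax, ‖A t‖ ≤ C) (hlen : C * (tmax - tmin) ≤ 1 / 2)
    (s : Icc tmin tmax) (u : E) :
    IsPicardLindelof (fun t x ↦ A t x) s u ‖u‖₊ 0 (C * (2 * ‖u‖₊)) C where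
  lipschitzOnWith t ht := ((A t).lipschitz.weaken (hC t ht)).lipschitzOnWith
  continuousOn x _ := hA.clm_apply continuousOn_const
  norm_le t ht x hx := by
    have hx' : ‖x‖ ≤ 2 * ‖u‖ := by
      rw [mem_closedBall_iff_norm, coe_nnnorm] at hx
      linarith [norm_le_norm_add_norm_sub' x u]
    exact (A t).le_of_opNorm_le_of_le (hC t ht) hx'
  mul_max_le := by
    have hmax : max (tmax - s) (s - tmin) ≤ tmax - tmin :=
      max_le (by linarith [s.2.1]) (by linarith [s.2.2])
    push_cast
    calc (C * (2 * ‖u‖) : ℝ) * max (tmax - s) (s - tmin) ≤ C * (2 * ‖u‖) * (tmax - tmin) := by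
          gcongr
      _ = 2 * ‖u‖ * (C * (tmax - tmin)) := by ring
      _ ≤ 2 * ‖u‖ * (1 / 2) := by gcongr
      _ = ‖u‖ - 0 := by ring

theorem exists_forall_hasDerivAt_linear [CompleteSpace E] {t₀ : ℝ}
    (hA : ∀ᶠ t in 𝓝 t₀, ContinuousAt A t) :
    ∃ ε > 0, ∀ s ∈ Ioo (t₀ - ε) (t₀ + ε), ∀ u : E, ∃ a : ℝ → E, a s = u ∧
      ∀ t ∈ Ioo (t₀ - ε) (t₀ + ε), HasDerivAt a (A t (a t)) t := by
  let C : ℝ≥0 := ‖A t₀‖₊ + 1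
  have hbound : ∀ᶠ t in 𝓝 t₀, ‖A t‖ < C :=
    hA.self_of_nhds.norm.eventually_lt_const (lt_add_one _)
  obtain ⟨δ, hδ, hball⟩ := nhds_basis_closedBall.mem_iff.1 (hA.and hbound)
  have : (0 : ℝ) < C := by positivity
  let ε : ℝ := min δ (1 / (4 * C))
  have hε : 0 < ε := by positivity
  have hlen : C * (t₀ + ε - (t₀ - ε)) ≤ 1 / 2 := by
    have hεC : ε * (4 * C) ≤ 1 := (le_div_iff₀ (by positivity)).1 (min_le_right _ _)
    linarith
  have hmem : ∀ t ∈ Icc (t₀ - ε) (t₀ + ε), ContinuousAt A t ∧ ‖A t‖ < C := fun t ht ↦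
    hball (closedBall_subset_closedBall (min_le_left _ _) (Real.closedBall_eq_Icc ▸ ht))
  refine ⟨ε, hε, fun s hs u ↦ ?_⟩
  obtain ⟨a, ha, ha'⟩ := (isPicardLindelof_linear
    (fun t ht ↦ (hmem t ht).1.continuousWithinAt) (fun t ht ↦ (hmem t ht).2.le) hlen
    ⟨s, Ioo_subset_Icc_self hs⟩ u).exists_eq_forall_mem_Icc_hasDerivWithinAt₀
  exact ⟨a, ha, fun t ht ↦
    (ha' t (Ioo_subset_Icc_self ht)).hasDerivAt (Icc_mem_nhds ht.1 ht.2)⟩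

end LinearODE

section VectorSpaceMetric

open Set Topology Filter

variable {E : Type*} [NormedAddCommGroup E] [NormedSpace ℝ E]

/-- Christoffel symbols of the first kind of a metric on a vector space whose derivative at a point
is `D`: the form `(v, w) ↦ ⟨∇_u v, w⟩` for constant vector fields `u`, `v`, `w`. -/
def christoffelForm (D : E →L[ℝ] E →L[ℝ] E →L[ℝ] ℝ) (u : E) : E →L[ℝ] E →L[ℝ] ℝ :=
  (1 / 2 : ℝ) • (D u + D.flip u - (D.flip u).flip)

theorem christoffelForm_apply (D : E →L[ℝ] E →L[ℝ] E →L[ℝ] ℝ) (u v w : E) :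
    christoffelForm D u v w = (D u v w + D v u w - D w u v) / 2 := by
  simp only [christoffelForm, smul_apply, sub_apply, add_apply, ContinuousLinearMap.flip_apply,
    smul_eq_mul]
  ring

theorem christoffelForm_smul (D : E →L[ℝ] E →L[ℝ] E →L[ℝ] ℝ) (r : ℝ) (u : E) :
    christoffelForm D (r • u) = r • christoffelForm D u := by
  ext v w
  simp only [smul_apply, christoffelForm_apply, map_smul, smul_eq_mul]
  ring

theorem continuousAt_christoffelForm {D : ℝ → E →L[ℝ] E →L[ℝ] E →L[ℝ] ℝ} {u : ℝ → E} {t : ℝ}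
    (hD : ContinuousAt D t) (hu : ContinuousAt u t) :
    ContinuousAt (fun s ↦ christoffelForm (D s) (u s)) t := by
  have hflip : ContinuousAt (fun s ↦ (D s).flip (u s)) t :=
    ((ContinuousLinearMap.flipₗᵢ ℝ E E (E →L[ℝ] ℝ)).continuous.continuousAt.comp hD).clm_apply hu
  have hflip' : ContinuousAt (fun s ↦ ((D s).flip (u s)).flip) t :=
    (ContinuousLinearMap.flipₗᵢ ℝ E E ℝ).continuous.continuousAt.comp hflip
  exact (((hD.clm_apply hu).add hflip).sub hflip').const_smul (1 / 2 : ℝ)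

/-- The vector field `a` along the curve `c` has zero covariant derivative at time `t`, for the
Levi-Civita connection of the metric `g` on a vector space. -/
def IsParallelIn (g : E → E →L[ℝ] E →L[ℝ] ℝ) (c a : ℝ → E) (t : ℝ) : Prop :=
  DifferentiableAt ℝ a t ∧
    g (c t) (deriv a t) + christoffelForm (fderiv ℝ g (c t)) (deriv c t) (a t) = 0

/-- The coefficient `A` of the linear equation `a' = A a` satisfied by the parallel fields `a` along
the curve `c`. -/
def parallelCoeff (g : E → E →L[ℝ] E →L[ℝ] ℝ) (c : ℝ → E) (t : ℝ) : E →L[ℝ] E :=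
  -(g (c t)).inverse.comp (christoffelForm (fderiv ℝ g (c t)) (deriv c t))

variable {g h : E → E →L[ℝ] E →L[ℝ] ℝ} {c a b : ℝ → E} {t : ℝ}

theorem isParallelIn_iff_hasDerivAt (hg : (g (c t)).IsInvertible) :
    IsParallelIn g c a t ↔ HasDerivAt a (parallelCoeff g c t (a t)) t := by
  obtain ⟨e, he⟩ := hg
  have hcoeff : parallelCoeff g c t (a t) =
      -e.symm (christoffelForm (fderiv ℝ g (c t)) (deriv c t) (a t)) := by
    rw [parallelCoeff, ← he, ContinuousLinearMap.inverse_equiv]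
    rfl
  rw [IsParallelIn, ← he, hcoeff]
  constructor
  · rintro ⟨hd, hzero⟩
    have hderiv : e (deriv a t) =
        e (-e.symm (christoffelForm (fderiv ℝ g (c t)) (deriv c t) (a t))) := by
      rw [map_neg, e.apply_symm_apply]
      exact eq_neg_of_add_eq_zero_left hzero
    rw [← e.injective hderiv]
    exact hd.hasDerivAt
  · intro h
    refine ⟨h.differentiableAt, ?_⟩
    rw [h.deriv, map_neg]
    simp

theorem continuousAt_parallelCoeff [CompleteSpace E] (hg : ContDiffAt ℝ 1 g (c t))
    (hc : ContDiffAt ℝ 1 c t) (hinv : (g (c t)).IsInvertible) :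
    ContinuousAt (parallelCoeff g c) t := by
  obtain ⟨e, he⟩ := hinv
  have hinverse : ContinuousAt (fun s ↦ (g (c s)).inverse) t := by
    refine ContinuousAt.comp (g := ContinuousLinearMap.inverse) (f := fun s ↦ g (c s)) ?_
      (ContinuousAt.comp (f := c) hg.continuousAt hc.continuousAt)
    rw [← he]
    exact (contDiffAt_map_inverse (n := 0) e).continuousAt
  have hfderiv : ContinuousAt (fun s ↦ fderiv ℝ g (c s)) t :=
    ContinuousAt.comp (f := c) (hg.fderiv_right (m := 0) (by simp)).continuousAt hc.continuousAt
  have hderiv : ContinuousAt (deriv c) t :=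
    (hc.fderiv_right (m := 0) (by simp)).continuousAt.clm_apply continuousAt_const
  exact (hinverse.clm_comp (continuousAt_christoffelForm hfderiv hderiv)).neg

theorem IsParallelIn.congr {c₁ a₁ : ℝ → E} (h : IsParallelIn g c a t) (hc : c₁ =ᶠ[𝓝 t] c)
    (ha : a₁ =ᶠ[𝓝 t] a) : IsParallelIn g c₁ a₁ t := by
  rw [IsParallelIn, hc.deriv_eq, hc.self_of_nhds, ha.deriv_eq, ha.self_of_nhds]
  exact ⟨h.1.congr_of_eventuallyEq ha, h.2⟩

theorem IsParallelIn.smul_add_smul (ha : IsParallelIn g c a t) (hb : IsParallelIn g c b t)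
    (r s : ℝ) : IsParallelIn g c (r • a + s • b) t := by
  have hd := (ha.1.hasDerivAt.const_smul r).add (hb.1.hasDerivAt.const_smul s)
  refine ⟨hd.differentiableAt, ?_⟩
  rw [hd.deriv]
  simp only [Pi.add_apply, Pi.smul_apply, map_add, map_smul]
  calc _ = r • (g (c t) (deriv a t) + christoffelForm (fderiv ℝ g (c t)) (deriv c t) (a t))
        + s • (g (c t) (deriv b t) + christoffelForm (fderiv ℝ g (c t)) (deriv c t) (b t)) := by
        module
    _ = 0 := by rw [ha.2, hb.2, smul_zero, smul_zero, add_zero]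

theorem IsParallelIn.comp_mul {r : ℝ} (h : IsParallelIn g c a (r * t)) :
    IsParallelIn g (fun s ↦ c (r * s)) (fun s ↦ a (r * s)) t := by
  refine ⟨h.1.comp t (differentiableAt_id.const_mul r), ?_⟩
  rw [deriv_comp_mul_left r a, deriv_comp_mul_left r c, christoffelForm_smul, map_smul, smul_apply,
    ← smul_add, h.2, smul_zero]

theorem fderiv_apply_comm {y : E} (hg : DifferentiableAt ℝ g y)
    (hsymm : ∀ᶠ x in 𝓝 y, ∀ v w, g x v w = g x w v) (u v w : E) :
    fderiv ℝ g y u v w = fderiv ℝ g y u w v := by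
  have hcoeff : ∀ v w : E, HasFDerivAt (fun x ↦ g x v w) (((fderiv ℝ g y).flip v).flip w) y :=
    fun v w ↦ ((hg.hasFDerivAt.clm_apply (hasFDerivAt_const v y)).clm_apply
      (hasFDerivAt_const w y)).congr_fderiv (by ext; simp)
  have heq := (hcoeff w v).congr_of_eventuallyEq (hsymm.mono fun x hx ↦ hx v w)
  exact DFunLike.congr_fun ((hcoeff v w).unique heq) u

theorem IsParallelIn.hasDerivAt_apply (ha : IsParallelIn g c a t) (hb : IsParallelIn g c b t)
    (hg : DifferentiableAt ℝ g (c t)) (hc : DifferentiableAt ℝ c t)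
    (hsymm : ∀ x v w, g x v w = g x w v) :
    HasDerivAt (fun s ↦ g (c s) (a s) (b s)) 0 t := by
  have hd : HasDerivAt (fun s ↦ g (c s) (a s) (b s))
      (fderiv ℝ g (c t) (deriv c t) (a t) (b t) + g (c t) (deriv a t) (b t)
        + g (c t) (a t) (deriv b t)) t :=
    ((hg.hasFDerivAt.comp_hasDerivAt t hc.hasDerivAt).clm_apply ha.1.hasDerivAt).clm_apply
      hb.1.hasDerivAt
  refine hd.congr_deriv ?_
  have hab := DFunLike.congr_fun ha.2 (b t)
  have hba := DFunLike.congr_fun hb.2 (a t)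
  simp only [add_apply, zero_apply, christoffelForm_apply] at hab hba
  rw [hsymm, fderiv_apply_comm hg (.of_forall hsymm) _ (b t)] at hba
  linarith

/-- The metric `g` is, near `y`, the pullback of the metric `h` under the map `τ`. -/
def IsPullbackAt (τ : E → E) (g h : E → E →L[ℝ] E →L[ℝ] ℝ) (y : E) : Prop :=
  ∀ᶠ x in 𝓝 y, ∀ v w, g x v w = h (τ x) (fderiv ℝ τ x v) (fderiv ℝ τ x w)

variable {τ : E → E} {y : E}

theorem IsPullbackAt.fderiv_apply (hgh : IsPullbackAt τ g h y) (hτ : ContDiffAt ℝ 2 τ y)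
    (hg : DifferentiableAt ℝ g y) (hh : DifferentiableAt ℝ h (τ y)) (u v w : E) :
    fderiv ℝ g y u v w =
      fderiv ℝ h (τ y) (fderiv ℝ τ y u) (fderiv ℝ τ y v) (fderiv ℝ τ y w)
        + h (τ y) (fderiv ℝ (fderiv ℝ τ) y u v) (fderiv ℝ τ y w)
        + h (τ y) (fderiv ℝ τ y v) (fderiv ℝ (fderiv ℝ τ) y u w) := by
  have hτ' := (hτ.differentiableAt two_ne_zero).hasFDerivAt
  have hτ'' : HasFDerivAt (fderiv ℝ τ) (fderiv ℝ (fderiv ℝ τ) y) y :=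
    ((hτ.fderiv_right (m := 1) (by norm_num)).differentiableAt one_ne_zero).hasFDerivAt
  have hleft := (hg.hasFDerivAt.clm_apply (hasFDerivAt_const v y)).clm_apply
    (hasFDerivAt_const w y)
  have hright := ((hh.hasFDerivAt.comp y hτ').clm_apply
    (hτ''.clm_apply (hasFDerivAt_const v y))).clm_apply (hτ''.clm_apply (hasFDerivAt_const w y))
  have heq := (hright.congr_of_eventuallyEq (hgh.mono fun x hx ↦ hx v w)).unique hleft
  have hu := DFunLike.congr_fun heq u
  simp only [Function.comp_apply, ContinuousLinearMap.comp_zero, zero_add,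
    ContinuousLinearMap.flip_add, add_apply, ContinuousLinearMap.comp_apply,
    ContinuousLinearMap.flip_apply] at hu
  linarith

theorem IsPullbackAt.christoffelForm_apply (hgh : IsPullbackAt τ g h y)
    (hτ : ContDiffAt ℝ 2 τ y) (hg : DifferentiableAt ℝ g y) (hh : DifferentiableAt ℝ h (τ y))
    (hsymm : ∀ x v w, h x v w = h x w v) (u v w : E) :
    christoffelForm (fderiv ℝ g y) u v w =
      christoffelForm (fderiv ℝ h (τ y)) (fderiv ℝ τ y u) (fderiv ℝ τ y v) (fderiv ℝ τ y w)
        + h (τ y) (fderiv ℝ (fderiv ℝ τ) y u v) (fderiv ℝ τ y w) := by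
  have hτsymm : ∀ u v, fderiv ℝ (fderiv ℝ τ) y u v = fderiv ℝ (fderiv ℝ τ) y v u :=
    hτ.isSymmSndFDerivAt (by simp)
  simp only [RPage.christoffelForm_apply, hgh.fderiv_apply hτ hg hh]
  rw [hτsymm v u, hτsymm w u, hτsymm w v, hsymm _ (fderiv ℝ τ y u),
    hsymm _ (fderiv ℝ τ y v)]
  ring

theorem IsParallelIn.of_isPullbackAt (ha : IsParallelIn g c a t)
    (hgh : IsPullbackAt τ g h (c t)) (hτ : ContDiffAt ℝ 2 τ (c t))
    (hg : DifferentiableAt ℝ g (c t)) (hh : DifferentiableAt ℝ h (τ (c t)))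
    (hsymm : ∀ x v w, h x v w = h x w v) (hc : DifferentiableAt ℝ c t)
    (hsurj : Function.Surjective (fderiv ℝ τ (c t))) :
    IsParallelIn h (τ ∘ c) (fun s ↦ fderiv ℝ τ (c s) (a s)) t := by
  have hτ' := (hτ.differentiableAt two_ne_zero).hasFDerivAt
  have hτ'' : HasFDerivAt (fderiv ℝ τ) (fderiv ℝ (fderiv ℝ τ) (c t)) (c t) :=
    ((hτ.fderiv_right (m := 1) (by norm_num)).differentiableAt one_ne_zero).hasFDerivAt
  have hτc := hτ'.comp_hasDerivAt t hc.hasDerivAt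
  have hd : HasDerivAt (fun s ↦ fderiv ℝ τ (c s) (a s))
      (fderiv ℝ (fderiv ℝ τ) (c t) (deriv c t) (a t) + fderiv ℝ τ (c t) (deriv a t)) t :=
    (hτ''.comp_hasDerivAt t hc.hasDerivAt).clm_apply ha.1.hasDerivAt
  refine ⟨hd.differentiableAt, ?_⟩
  ext w
  obtain ⟨w, rfl⟩ := hsurj w
  have hw := DFunLike.congr_fun ha.2 w
  rw [add_apply, zero_apply, hgh.christoffelForm_apply hτ hg hh hsymm,
    hgh.self_of_nhds] at hw
  rw [hd.deriv, hτc.deriv, Function.comp_apply, map_add, add_apply, add_apply, zero_apply]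
  linarith

end VectorSpaceMetric

section Charts

open Set Topology Filter

variable {E : Type*} [NormedAddCommGroup E] [NormedSpace ℝ E]
  {M : Type*} [TopologicalSpace M] [ChartedSpace E M] {z q p : M}

/-- The transition map from the chart at `z` to the chart at `p`. -/
def transition (z p : M) : E → E :=
  extChartAt 𝓘(ℝ, E) p ∘ (extChartAt 𝓘(ℝ, E) z).symm

theorem transition_extChartAt (hz : q ∈ (chartAt E z).source) :
    transition z p (extChartAt 𝓘(ℝ, E) z q) = extChartAt 𝓘(ℝ, E) p q := by
  rw [transition, Function.comp_apply,
    (extChartAt 𝓘(ℝ, E) z).left_inv (by rwa [extChartAt_source])]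

variable [IsManifold 𝓘(ℝ, E) ∞ M]

/-- The coordinates, in the preferred chart at `z`, of a tangent vector at `q`
(a junk value when `q` lies outside the chart). -/
def toCoord (z q : M) : TangentSpace 𝓘(ℝ, E) q →L[ℝ] E :=
  (trivializationAt E (TangentSpace 𝓘(ℝ, E)) z).continuousLinearMapAt ℝ q

/-- The tangent vector at `q` with given coordinates in the preferred chart at `z`
(a junk value when `q` lies outside the chart). -/
def ofCoord (z q : M) : E →L[ℝ] TangentSpace 𝓘(ℝ, E) q :=
  (trivializationAt E (TangentSpace 𝓘(ℝ, E)) z).symmL ℝ q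

theorem ofCoord_toCoord (hq : q ∈ (chartAt E z).source) (v : TangentSpace 𝓘(ℝ, E) q) :
    ofCoord z q (toCoord z q v) = v :=
  (trivializationAt E (TangentSpace 𝓘(ℝ, E)) z).symmL_continuousLinearMapAt hq v

theorem toCoord_ofCoord (hq : q ∈ (chartAt E z).source) (a : E) :
    toCoord z q (ofCoord z q a) = a :=
  (trivializationAt E (TangentSpace 𝓘(ℝ, E)) z).continuousLinearMapAt_symmL hq a

theorem toCoord_apply (hq : q ∈ (chartAt E z).source) (v : TangentSpace 𝓘(ℝ, E) q) :
    (trivializationAt E (TangentSpace 𝓘(ℝ, E)) z ⟨q, v⟩).2 = toCoord z q v :=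
  ((trivializationAt E (TangentSpace 𝓘(ℝ, E)) z).continuousLinearMapAt_apply_of_mem ℝ hq v).symm

theorem ofCoord_apply (hq : q ∈ (chartAt E z).source) (a : E) :
    (trivializationAt E (TangentSpace 𝓘(ℝ, E)) z).symm q a = ofCoord z q a :=
  ((trivializationAt E (TangentSpace 𝓘(ℝ, E)) z).symmL_apply hq a).symm

theorem coordField_eq (hq : q ∈ (chartAt E z).source) (v : TangentSpace 𝓘(ℝ, E) z) :
    coordField z v q = ofCoord z q (toCoord z z v) := by
  rw [coordField, toCoord_apply (mem_chart_source E z), ofCoord_apply hq]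

theorem hasMFDerivAt_extChartAt_toCoord (hq : q ∈ (chartAt E z).source) :
    HasMFDerivAt 𝓘(ℝ, E) 𝓘(ℝ, E) (extChartAt 𝓘(ℝ, E) z) q (toCoord z q) := by
  have h : MDifferentiableAt 𝓘(ℝ, E) 𝓘(ℝ, E) (extChartAt 𝓘(ℝ, E) z) q :=
    mdifferentiableAt_extChartAt hq
  have := h.hasMFDerivAt
  rw [← TangentBundle.continuousLinearMapAt_trivializationAt hq] at this
  exact this

theorem contDiffAt_transition (hz : q ∈ (chartAt E z).source) (hp : q ∈ (chartAt E p).source) :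
    ContDiffAt ℝ ∞ (transition z p) (extChartAt 𝓘(ℝ, E) z q) := by
  have h := 𝓘(ℝ, E).contDiffWithinAt_extendCoordChange' (n := ∞) (x := q)
    (IsManifold.chart_mem_maximalAtlas z) (IsManifold.chart_mem_maximalAtlas p) hz hp
  rw [𝓘(ℝ, E).range_eq_univ, contDiffWithinAt_univ] at h
  exact h

theorem fderiv_transition_toCoord (hz : q ∈ (chartAt E z).source)
    (hp : q ∈ (chartAt E p).source) (v : TangentSpace 𝓘(ℝ, E) q) :
    fderiv ℝ (transition z p) (extChartAt 𝓘(ℝ, E) z q) (toCoord z q v) = toCoord p q v := by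
  have hcomp := ((contDiffAt_transition hz hp).differentiableAt (by simp)).hasFDerivAt.hasMFDerivAt
    |>.comp q (hasMFDerivAt_extChartAt_toCoord hz)
  have heq : extChartAt 𝓘(ℝ, E) p =ᶠ[𝓝 q] transition z p ∘ extChartAt 𝓘(ℝ, E) z := by
    filter_upwards [(chartAt E z).open_source.mem_nhds hz] with x hx
    exact (transition_extChartAt hx).symm
  exact DFunLike.congr_fun (hasMFDerivAt_unique (hcomp.congr_of_eventuallyEq heq)
    (hasMFDerivAt_extChartAt_toCoord hp)) v

theorem surjective_fderiv_transition (hz : q ∈ (chartAt E z).source)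
    (hp : q ∈ (chartAt E p).source) :
    Function.Surjective (fderiv ℝ (transition z p) (extChartAt 𝓘(ℝ, E) z q)) := fun a ↦
  ⟨toCoord z q (ofCoord p q a), by rw [fderiv_transition_toCoord hz hp, toCoord_ofCoord hp]⟩

theorem ofCoord_fderiv_transition (hz : q ∈ (chartAt E z).source)
    (hp : q ∈ (chartAt E p).source) (a : E) :
    ofCoord p q (fderiv ℝ (transition z p) (extChartAt 𝓘(ℝ, E) z q) a) = ofCoord z q a := by
  rw [← toCoord_ofCoord hz a, fderiv_transition_toCoord hz hp, ofCoord_toCoord hp,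
    ofCoord_toCoord hz]

variable [RiemannianBundle (fun x : M ↦ TangentSpace 𝓘(ℝ, E) x)]

/-- The Riemannian metric in the preferred chart at `z`, as a function on the model space. -/
def chartMetric (z : M) (y : E) : E →L[ℝ] E →L[ℝ] ℝ :=
  (innerSL ℝ (E := TangentSpace 𝓘(ℝ, E) ((extChartAt 𝓘(ℝ, E) z).symm y))).bilinearComp
    (ofCoord z ((extChartAt 𝓘(ℝ, E) z).symm y)) (ofCoord z ((extChartAt 𝓘(ℝ, E) z).symm y))

theorem chartMetric_apply (hq : q ∈ (chartAt E z).source) (a b : E) :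
    chartMetric z (extChartAt 𝓘(ℝ, E) z q) a b = inner ℝ (ofCoord z q a) (ofCoord z q b) := by
  change inner ℝ (ofCoord z ((extChartAt 𝓘(ℝ, E) z).symm _) a) (ofCoord z _ b) = _
  rw [(extChartAt 𝓘(ℝ, E) z).left_inv (by rwa [extChartAt_source])]

theorem chartMetric_comm (z : M) (y a b : E) : chartMetric z y a b = chartMetric z y b a :=
  real_inner_comm (ofCoord z _ b) (ofCoord z _ a)

theorem isPullbackAt_transition (hz : q ∈ (chartAt E z).source)
    (hp : q ∈ (chartAt E p).source) :
    IsPullbackAt (transition z p) (chartMetric z) (chartMetric p) (extChartAt 𝓘(ℝ, E) z q) := by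
  have hmap : map (extChartAt 𝓘(ℝ, E) z) (𝓝 q) = 𝓝 (extChartAt 𝓘(ℝ, E) z q) := by
    rw [map_extChartAt_nhds' (by rwa [extChartAt_source]), 𝓘(ℝ, E).range_eq_univ, nhdsWithin_univ]
  rw [IsPullbackAt, ← hmap, eventually_map]
  filter_upwards [(chartAt E z).open_source.mem_nhds hz, (chartAt E p).open_source.mem_nhds hp]
    with x hxz hxp v w
  rw [transition_extChartAt hxz, chartMetric_apply hxz, chartMetric_apply hxp,
    ofCoord_fderiv_transition hxz hxp, ofCoord_fderiv_transition hxz hxp]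

variable [IsContMDiffRiemannianBundle 𝓘(ℝ, E) ∞ E (fun x : M ↦ TangentSpace 𝓘(ℝ, E) x)]

theorem contMDiffOn_inner_ofCoord (z : M) (a b : E) :
    ContMDiffOn 𝓘(ℝ, E) 𝓘(ℝ, ℝ) ∞
      (fun q : M ↦ (inner ℝ (ofCoord z q a) (ofCoord z q b) : ℝ)) (chartAt E z).source := by
  have hsmooth : ∀ a : E, ContMDiffOn 𝓘(ℝ, E) (𝓘(ℝ, E).prod 𝓘(ℝ, E)) ∞
      (fun q : M ↦ (⟨q, ofCoord z q a⟩ : TotalSpace E (fun x : M ↦ TangentSpace 𝓘(ℝ, E) x)))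
      (chartAt E z).source := by
    intro a q hq
    apply ContMDiffAt.contMDiffWithinAt
    refine ((trivializationAt E (TangentSpace 𝓘(ℝ, E)) z).contMDiffAt_section_iff hq).2 ?_
    refine (contMDiffAt_const (c := a)).congr_of_eventuallyEq ?_
    filter_upwards [(chartAt E z).open_source.mem_nhds hq] with x hx
    rw [toCoord_apply hx, toCoord_ofCoord hx]
  exact ContMDiffOn.inner_bundle (F := E) (E := fun x : M ↦ TangentSpace 𝓘(ℝ, E) x)
    (b := fun q ↦ q) (v := fun q ↦ ofCoord z q a) (w := fun q ↦ ofCoord z q b)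
    (hsmooth a) (hsmooth b)

variable [FiniteDimensional ℝ E]

theorem contDiffOn_chartMetric (z : M) :
    ContDiffOn ℝ ∞ (chartMetric (E := E) z) (extChartAt 𝓘(ℝ, E) z).target := by
  refine contDiffOn_clm_apply.2 fun a ↦ contDiffOn_clm_apply.2 fun b ↦ ?_
  rw [← contMDiffOn_iff_contDiffOn]
  refine (contMDiffOn_inner_ofCoord z a b).comp (contMDiffOn_extChartAt_symm z) ?_
  intro y hy
  have := (extChartAt 𝓘(ℝ, E) z).map_target hy
  rwa [extChartAt_source] at this

theorem contDiffAt_chartMetric (hq : q ∈ (chartAt E z).source) :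
    ContDiffAt ℝ ∞ (chartMetric (E := E) z) (extChartAt 𝓘(ℝ, E) z q) :=
  (contDiffOn_chartMetric z).contDiffAt (extChartAt_target_mem_nhds'
    ((extChartAt 𝓘(ℝ, E) z).map_source (by rwa [extChartAt_source])))

theorem differentiableAt_chartMetric (hq : q ∈ (chartAt E z).source) :
    DifferentiableAt ℝ (chartMetric (E := E) z) (extChartAt 𝓘(ℝ, E) z q) :=
  (contDiffAt_chartMetric hq).differentiableAt (by simp)

theorem metricDeriv_eq_fderiv (u v w : TangentSpace 𝓘(ℝ, E) p) :
    metricDeriv p u v w = fderiv ℝ (chartMetric p) (extChartAt 𝓘(ℝ, E) p p) (toCoord p p u)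
      (toCoord p p v) (toCoord p p w) := by
  have hp := mem_chart_source E p
  have hcoeff : HasFDerivAt (fun y ↦ chartMetric p y (toCoord p p v) (toCoord p p w))
      (((fderiv ℝ (chartMetric p) (extChartAt 𝓘(ℝ, E) p p)).flip (toCoord p p v)).flip
        (toCoord p p w)) (extChartAt 𝓘(ℝ, E) p p) :=
    (((differentiableAt_chartMetric hp).hasFDerivAt.clm_apply (hasFDerivAt_const _ _)).clm_apply
      (hasFDerivAt_const _ _)).congr_fderiv (by ext; simp)
  have hcomp := hcoeff.hasMFDerivAt.comp p (hasMFDerivAt_extChartAt_toCoord hp)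
  have heq : (fun q : M ↦ (inner ℝ (coordField p v q) (coordField p w q) : ℝ)) =ᶠ[𝓝 p]
      (fun y ↦ chartMetric p y (toCoord p p v) (toCoord p p w)) ∘ extChartAt 𝓘(ℝ, E) p := by
    filter_upwards [(chartAt E p).open_source.mem_nhds hp] with q hq
    rw [coordField_eq hq, coordField_eq hq, Function.comp_apply, chartMetric_apply hq]
  rw [metricDeriv, (hcomp.congr_of_eventuallyEq heq).mfderiv]
  rfl

theorem christoffel_eq_christoffelForm (u v w : TangentSpace 𝓘(ℝ, E) p) :
    christoffel p u v w = christoffelForm (fderiv ℝ (chartMetric p) (extChartAt 𝓘(ℝ, E) p p))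
      (toCoord p p u) (toCoord p p v) (toCoord p p w) := by
  simp only [christoffel, christoffelForm_apply, metricDeriv_eq_fderiv]

end Charts

section Curves

open Set Topology Filter

variable {E : Type*} [NormedAddCommGroup E] [NormedSpace ℝ E]
  {M : Type*} [TopologicalSpace M] [ChartedSpace E M] [IsManifold 𝓘(ℝ, E) ∞ M]
  {z p : M} {γ : ℝ → M} {t : ℝ} {V W : ∀ t, TangentSpace 𝓘(ℝ, E) (γ t)}

theorem hasDerivAt_extChartAt_comp (hγ : MDifferentiableAt 𝓘(ℝ, ℝ) 𝓘(ℝ, E) γ t)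
    (hz : γ t ∈ (chartAt E z).source) :
    HasDerivAt (extChartAt 𝓘(ℝ, E) z ∘ γ) (toCoord z (γ t) (velocity γ t)) t := by
  have hcomp : HasFDerivAt (extChartAt 𝓘(ℝ, E) z ∘ γ)
      ((toCoord z (γ t)).comp (mfderiv 𝓘(ℝ, ℝ) 𝓘(ℝ, E) γ t) : ℝ →L[ℝ] E) t :=
    hasMFDerivAt_iff_hasFDerivAt.1 ((hasMFDerivAt_extChartAt_toCoord hz).comp t hγ.hasMFDerivAt)
  exact HasFDerivAt.hasDerivAt (F := E) hcomp

/-- The coordinates, in the preferred chart at `z`, of a vector field along `γ`. -/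
def fieldCoord (z : M) (γ : ℝ → M) (V : ∀ t, TangentSpace 𝓘(ℝ, E) (γ t)) (t : ℝ) : E :=
  toCoord z (γ t) (V t)

theorem coordAlong_eventuallyEq (hγ : ContinuousAt γ t) :
    coordAlong γ V t =ᶠ[𝓝 t] fieldCoord (γ t) γ V := by
  filter_upwards [hγ ((chartAt E (γ t)).open_source.mem_nhds (mem_chart_source E _))] with s hs
  exact toCoord_apply hs (V s)

variable [RiemannianBundle (fun x : M ↦ TangentSpace 𝓘(ℝ, E) x)]

/-- The vector field `V` along `γ` has vanishing covariant derivative at time `t`. -/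
def IsParallelAt (γ : ℝ → M) (V : ∀ t, TangentSpace 𝓘(ℝ, E) (γ t)) (t : ℝ) : Prop :=
  DifferentiableAt ℝ (coordAlong γ V t) t ∧
    ∀ w : TangentSpace 𝓘(ℝ, E) (γ t),
      inner ℝ ((trivializationAt E (TangentSpace 𝓘(ℝ, E)) (γ t)).symm (γ t)
          (deriv (coordAlong γ V t) t)) w
        + christoffel (γ t) (velocity γ t) (V t) w = 0

variable [IsContMDiffRiemannianBundle 𝓘(ℝ, E) ∞ E (fun x : M ↦ TangentSpace 𝓘(ℝ, E) x)]
  [FiniteDimensional ℝ E]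

theorem isParallelIn_transition (hγ : MDifferentiableAt 𝓘(ℝ, ℝ) 𝓘(ℝ, E) γ t)
    (hz : γ t ∈ (chartAt E z).source) (hp : γ t ∈ (chartAt E p).source)
    (h : IsParallelIn (chartMetric z) (extChartAt 𝓘(ℝ, E) z ∘ γ) (fieldCoord z γ V) t) :
    IsParallelIn (chartMetric p) (extChartAt 𝓘(ℝ, E) p ∘ γ) (fieldCoord p γ V) t := by
  have hmem : ∀ᶠ s in 𝓝 t, γ s ∈ (chartAt E z).source ∧ γ s ∈ (chartAt E p).source :=
    hγ.continuousAt.eventually (((chartAt E z).open_source.eventually_mem hz).and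
      ((chartAt E p).open_source.eventually_mem hp))
  have hτ : ContDiffAt ℝ 2 (transition z p) (extChartAt 𝓘(ℝ, E) z (γ t)) :=
    (contDiffAt_transition hz hp).of_le ENat.LEInfty.out
  have hg : DifferentiableAt ℝ (chartMetric p) (transition z p (extChartAt 𝓘(ℝ, E) z (γ t))) := by
    rw [transition_extChartAt hz]
    exact differentiableAt_chartMetric hp
  refine (h.of_isPullbackAt (isPullbackAt_transition hz hp) hτ (differentiableAt_chartMetric hz)
    hg (chartMetric_comm p) (hasDerivAt_extChartAt_comp hγ hz).differentiableAt
    (surjective_fderiv_transition hz hp)).congr ?_ ?_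
  · filter_upwards [hmem] with s hs
    exact (transition_extChartAt hs.1).symm
  · filter_upwards [hmem] with s hs
    exact (fderiv_transition_toCoord hs.1 hs.2 (V s)).symm

theorem isParallelAt_iff_isParallelIn_self (hγ : MDifferentiableAt 𝓘(ℝ, ℝ) 𝓘(ℝ, E) γ t) :
    IsParallelAt γ V t ↔
      IsParallelIn (chartMetric (γ t)) (extChartAt 𝓘(ℝ, E) (γ t) ∘ γ) (fieldCoord (γ t) γ V) t := by
  have hp := mem_chart_source E (γ t)
  have heq := coordAlong_eventuallyEq (V := V) hγ.continuousAt
  rw [IsParallelAt, IsParallelIn, heq.differentiableAt_iff, heq.deriv_eq,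
    (hasDerivAt_extChartAt_comp hγ hp).deriv, DFunLike.ext_iff]
  refine and_congr_right fun _ ↦ ⟨fun h w ↦ ?_, fun h w ↦ ?_⟩
  · have hw := h (ofCoord (γ t) (γ t) w)
    rwa [ofCoord_apply hp, ← chartMetric_apply hp, christoffel_eq_christoffelForm,
      toCoord_ofCoord hp] at hw
  · have hw := h (toCoord (γ t) (γ t) w)
    rwa [add_apply, Function.comp_apply, chartMetric_apply hp, ofCoord_toCoord hp,
      ← ofCoord_apply hp, fieldCoord, ← christoffel_eq_christoffelForm] at hw

theorem isParallelAt_iff_isParallelIn (hγ : MDifferentiableAt 𝓘(ℝ, ℝ) 𝓘(ℝ, E) γ t)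
    (hz : γ t ∈ (chartAt E z).source) :
    IsParallelAt γ V t ↔
      IsParallelIn (chartMetric z) (extChartAt 𝓘(ℝ, E) z ∘ γ) (fieldCoord z γ V) t :=
  (isParallelAt_iff_isParallelIn_self hγ).trans
    ⟨isParallelIn_transition hγ (mem_chart_source E _) hz,
      isParallelIn_transition hγ hz (mem_chart_source E _)⟩

theorem IsParallelAt.congr (hγ : MDifferentiableAt 𝓘(ℝ, ℝ) 𝓘(ℝ, E) γ t)
    (hV : IsParallelAt γ V t) (hW : ∀ᶠ s in 𝓝 t, W s = V s) : IsParallelAt γ W t := by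
  rw [isParallelAt_iff_isParallelIn_self hγ] at hV ⊢
  exact hV.congr .rfl (hW.mono fun s hs ↦ congrArg (toCoord (γ t) (γ s)) hs)

theorem IsParallelAt.smul_add_smul (hγ : MDifferentiableAt 𝓘(ℝ, ℝ) 𝓘(ℝ, E) γ t)
    (hV : IsParallelAt γ V t) (hW : IsParallelAt γ W t) (a b : ℝ) :
    IsParallelAt γ (fun s ↦ a • V s + b • W s) t := by
  rw [isParallelAt_iff_isParallelIn_self hγ] at hV hW ⊢
  refine (hV.smul_add_smul hW a b).congr .rfl (.of_forall fun s ↦ ?_)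
  simp [fieldCoord]

theorem IsParallelAt.hasDerivAt_inner (hγ : MDifferentiableAt 𝓘(ℝ, ℝ) 𝓘(ℝ, E) γ t)
    (hV : IsParallelAt γ V t) (hW : IsParallelAt γ W t) :
    HasDerivAt (fun s ↦ (inner ℝ (V s) (W s) : ℝ)) 0 t := by
  have hp := mem_chart_source E (γ t)
  rw [isParallelAt_iff_isParallelIn_self hγ] at hV hW
  refine (hV.hasDerivAt_apply hW (differentiableAt_chartMetric hp)
    (hasDerivAt_extChartAt_comp hγ hp).differentiableAt
    (chartMetric_comm _)).congr_of_eventuallyEq ?_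
  filter_upwards [hγ.continuousAt ((chartAt E (γ t)).open_source.mem_nhds hp)] with s hs
  rw [Function.comp_apply, chartMetric_apply hs, fieldCoord, fieldCoord, ofCoord_toCoord hs,
    ofCoord_toCoord hs]

end Curves

section ParallelTransport

open Set Topology Filter

theorem isInvertible_of_definite {F : Type*} [NormedAddCommGroup F] [NormedSpace ℝ F]
    [FiniteDimensional ℝ F] {g : F →L[ℝ] F →L[ℝ] ℝ} (hg : ∀ a, g a a = 0 → a = 0) :
    g.IsInvertible := by
  have hinj : Function.Injective (g : F →ₗ[ℝ] F →L[ℝ] ℝ) :=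
    (injective_iff_map_eq_zero _).2 fun a ha ↦ hg a (DFunLike.congr_fun ha a)
  have hrank : Module.finrank ℝ F = Module.finrank ℝ (F →L[ℝ] ℝ) :=
    Subspace.dual_finrank_eq.symm.trans
      (LinearMap.toContinuousLinearMap (𝕜 := ℝ) (E := F) (F' := ℝ)).finrank_eq
  exact ⟨(LinearEquiv.ofInjectiveOfFinrankEq _ hinj hrank).toContinuousLinearEquiv, rfl⟩

variable {E : Type*} [NormedAddCommGroup E] [NormedSpace ℝ E] [FiniteDimensional ℝ E]
  {M : Type*} [TopologicalSpace M] [ChartedSpace E M] [IsManifold 𝓘(ℝ, E) ∞ M]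
  [RiemannianBundle (fun x : M ↦ TangentSpace 𝓘(ℝ, E) x)]
  {z q : M} {γ : ℝ → M} {V W : ∀ t, TangentSpace 𝓘(ℝ, E) (γ t)} {U U' : Set ℝ} {a b : ℝ}

theorem isInvertible_chartMetric (hq : q ∈ (chartAt E z).source) :
    (chartMetric z (extChartAt 𝓘(ℝ, E) z q)).IsInvertible := by
  refine isInvertible_of_definite fun a ha ↦ ?_
  rw [chartMetric_apply hq, inner_self_eq_zero] at ha
  rw [← toCoord_ofCoord hq a, ha, map_zero]

variable [IsContMDiffRiemannianBundle 𝓘(ℝ, E) ∞ E (fun x : M ↦ TangentSpace 𝓘(ℝ, E) x)]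

theorem inner_eq_of_isParallelAt (hγ : MDifferentiable 𝓘(ℝ, ℝ) 𝓘(ℝ, E) γ) (hU : IsOpen U)
    (hUc : IsPreconnected U) (hV : ∀ t ∈ U, IsParallelAt γ V t)
    (hW : ∀ t ∈ U, IsParallelAt γ W t) (ha : a ∈ U) (hb : b ∈ U) :
    (inner ℝ (V a) (W a) : ℝ) = inner ℝ (V b) (W b) := by
  have hd : ∀ t ∈ U, HasDerivAt (fun s ↦ (inner ℝ (V s) (W s) : ℝ)) 0 t := fun t ht ↦
    (hV t ht).hasDerivAt_inner (hγ t) (hW t ht)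
  exact hU.is_const_of_deriv_eq_zero hUc
    (fun t ht ↦ (hd t ht).differentiableAt.differentiableWithinAt)
    (fun t ht ↦ (hd t ht).deriv) ha hb

theorem eq_of_isParallelAt (hγ : MDifferentiable 𝓘(ℝ, ℝ) 𝓘(ℝ, E) γ) (hU : IsOpen U)
    (hUc : IsPreconnected U) (hV : ∀ t ∈ U, IsParallelAt γ V t)
    (hW : ∀ t ∈ U, IsParallelAt γ W t) (ha : a ∈ U) (hb : b ∈ U) (h : V a = W a) :
    V b = W b := by
  have hsub : ∀ t ∈ U, IsParallelAt γ (fun s ↦ (1 : ℝ) • V s + (-1 : ℝ) • W s) t := fun t ht ↦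
    (hV t ht).smul_add_smul (hγ t) (hW t ht) _ _
  have hinner := inner_eq_of_isParallelAt hγ hU hUc hsub hsub ha hb
  simp only [h, one_smul, neg_one_smul, add_neg_cancel, inner_zero_left] at hinner
  exact eq_of_sub_eq_zero ((sub_eq_add_neg _ _).trans (inner_self_eq_zero.1 hinner.symm))

/-- Parallel fields along `γ` with arbitrary initial values exist on `U`. -/
def ParallelSolvableOn (γ : ℝ → M) (U : Set ℝ) : Prop :=
  ∀ s ∈ U, ∀ u : TangentSpace 𝓘(ℝ, E) (γ s), ∃ V : ∀ t, TangentSpace 𝓘(ℝ, E) (γ t),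
    V s = u ∧ ∀ t ∈ U, IsParallelAt γ V t

theorem isParallelAt_ofCoord (hγ : MDifferentiable 𝓘(ℝ, ℝ) 𝓘(ℝ, E) γ) {v : ℝ → E} {t : ℝ}
    (ht : γ t ∈ (chartAt E z).source)
    (hv : HasDerivAt v (parallelCoeff (chartMetric z) (extChartAt 𝓘(ℝ, E) z ∘ γ) t (v t)) t) :
    IsParallelAt γ (fun s ↦ ofCoord z (γ s) (v s)) t := by
  rw [isParallelAt_iff_isParallelIn (hγ t) ht]
  have hinv : (chartMetric z ((extChartAt 𝓘(ℝ, E) z ∘ γ) t)).IsInvertible :=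
    isInvertible_chartMetric ht
  have hparallel : IsParallelIn (chartMetric z) (extChartAt 𝓘(ℝ, E) z ∘ γ) v t :=
    (isParallelIn_iff_hasDerivAt hinv).2 hv
  refine hparallel.congr .rfl ?_
  filter_upwards [(hγ t).continuousAt.eventually
    ((chartAt E z).open_source.eventually_mem ht)] with s hs
  exact toCoord_ofCoord hs (v s)

theorem eventually_continuousAt_parallelCoeff (hγ : ContMDiff 𝓘(ℝ, ℝ) 𝓘(ℝ, E) 1 γ) {t₀ : ℝ}
    (ht₀ : γ t₀ ∈ (chartAt E z).source) : ∀ᶠ t in 𝓝 t₀,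
      ContinuousAt (parallelCoeff (chartMetric z) (extChartAt 𝓘(ℝ, E) z ∘ γ)) t := by
  filter_upwards [hγ.continuous.continuousAt.eventually
    ((chartAt E z).open_source.eventually_mem ht₀)] with t ht
  have hc : ContDiffAt ℝ 1 (extChartAt 𝓘(ℝ, E) z ∘ γ) t :=
    contMDiffAt_iff_contDiffAt.1 ((contMDiffAt_extChartAt' ht).comp t hγ.contMDiffAt)
  exact continuousAt_parallelCoeff ((contDiffAt_chartMetric ht).of_le (by simp)) hc
    (isInvertible_chartMetric ht)

theorem exists_parallelSolvableOn_Ioo (hγ : ContMDiff 𝓘(ℝ, ℝ) 𝓘(ℝ, E) 1 γ) (t₀ : ℝ) :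
    ∃ ε > 0, ParallelSolvableOn (E := E) γ (Ioo (t₀ - ε) (t₀ + ε)) := by
  have hz := mem_chart_source E (γ t₀)
  obtain ⟨ε₁, hε₁, hode⟩ :=
    exists_forall_hasDerivAt_linear (eventually_continuousAt_parallelCoeff hγ hz)
  obtain ⟨ε₂, hε₂, hsource⟩ := Metric.eventually_nhds_iff_ball.1
    (hγ.continuous.continuousAt.eventually
      ((chartAt E (γ t₀)).open_source.eventually_mem hz))
  have hsub₁ : Ioo (t₀ - min ε₁ ε₂) (t₀ + min ε₁ ε₂) ⊆ Ioo (t₀ - ε₁) (t₀ + ε₁) := by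
    gcongr <;> exact min_le_left _ _
  have hsub₂ : Ioo (t₀ - min ε₁ ε₂) (t₀ + min ε₁ ε₂) ⊆ Metric.ball t₀ ε₂ := by
    rw [Real.ball_eq_Ioo]
    gcongr <;> exact min_le_right _ _
  refine ⟨min ε₁ ε₂, by positivity, fun s hs u ↦ ?_⟩
  obtain ⟨v, hvs, hv⟩ := hode s (hsub₁ hs) (toCoord (γ t₀) (γ s) u)
  refine ⟨fun t ↦ ofCoord (γ t₀) (γ t) (v t), ?_, fun t ht ↦ ?_⟩
  · simp only [hvs, ofCoord_toCoord (hsource s (hsub₂ hs))]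
  · exact isParallelAt_ofCoord (hγ.mdifferentiable one_ne_zero) (hsource t (hsub₂ ht))
      (hv t (hsub₁ ht))

theorem ParallelSolvableOn.exists_union (hγ : MDifferentiable 𝓘(ℝ, ℝ) 𝓘(ℝ, E) γ)
    (hU : IsOpen U) (hU' : IsOpen U') (hc : IsPreconnected (U ∩ U')) (hne : (U ∩ U').Nonempty)
    (h : ParallelSolvableOn (E := E) γ U) (h' : ParallelSolvableOn (E := E) γ U')
    {s : ℝ} (hs : s ∈ U) (u : TangentSpace 𝓘(ℝ, E) (γ s)) :
    ∃ V : ∀ t, TangentSpace 𝓘(ℝ, E) (γ t), V s = u ∧ ∀ t ∈ U ∪ U', IsParallelAt γ V t := by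
  classical
  obtain ⟨y, hy⟩ := hne
  obtain ⟨V, hVs, hV⟩ := h s hs u
  obtain ⟨W, hWy, hW⟩ := h' y hy.2 (V y)
  have hVW : ∀ t ∈ U ∩ U', V t = W t := fun t ht ↦
    eq_of_isParallelAt hγ (hU.inter hU') hc (fun t ht ↦ hV t ht.1) (fun t ht ↦ hW t ht.2) hy ht
      hWy.symm
  refine ⟨fun t ↦ if t ∈ U then V t else W t, by simp [hs, hVs], fun t ht ↦ ?_⟩
  rcases ht with ht | ht
  · refine (hV t ht).congr (hγ t) ?_
    filter_upwards [hU.mem_nhds ht] with s hs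
    simp [hs]
  · refine (hW t ht).congr (hγ t) ?_
    filter_upwards [hU'.mem_nhds ht] with s hs
    by_cases hsU : s ∈ U
    · simp [hsU, hVW s ⟨hsU, hs⟩]
    · simp [hsU]

theorem ParallelSolvableOn.union (hγ : MDifferentiable 𝓘(ℝ, ℝ) 𝓘(ℝ, E) γ) (hU : IsOpen U)
    (hU' : IsOpen U') (hc : IsPreconnected (U ∩ U')) (hne : (U ∩ U').Nonempty)
    (h : ParallelSolvableOn (E := E) γ U) (h' : ParallelSolvableOn (E := E) γ U') :
    ParallelSolvableOn (E := E) γ (U ∪ U') := by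
  rintro s (hs | hs) u
  · exact h.exists_union hγ hU hU' hc hne h' hs u
  · rw [inter_comm] at hc hne
    rw [union_comm]
    exact h'.exists_union hγ hU' hU hc hne h hs u

theorem exists_parallelSolvableOn (hγ : ContMDiff 𝓘(ℝ, ℝ) 𝓘(ℝ, E) 1 γ) (a b : ℝ) :
    ∃ U : Set ℝ, IsOpen U ∧ IsPreconnected U ∧ a ∈ U ∧ b ∈ U ∧
      ParallelSolvableOn (E := E) γ U := by
  refine PreconnectedSpace.induction₂' (fun a b : ℝ ↦ ∃ U : Set ℝ, IsOpen U ∧ IsPreconnected U ∧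
    a ∈ U ∧ b ∈ U ∧ ParallelSolvableOn (E := E) γ U) (fun x ↦ ?_) ⟨?_⟩ a b
  · obtain ⟨ε, hε, h⟩ := exists_parallelSolvableOn_Ioo hγ x
    have hx : x ∈ Ioo (x - ε) (x + ε) := ⟨by linarith, by linarith⟩
    filter_upwards [isOpen_Ioo.mem_nhds hx] with y hy
    exact ⟨⟨_, isOpen_Ioo, isPreconnected_Ioo, hx, hy, h⟩,
      ⟨_, isOpen_Ioo, isPreconnected_Ioo, hy, hx, h⟩⟩
  · rintro x y w ⟨U, hU, hUc, hxU, hyU, h⟩ ⟨U', hU', hUc', hyU', hwU', h'⟩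
    exact ⟨U ∪ U', hU.union hU', hUc.union y hyU hyU' hUc', Or.inl hxU, Or.inr hwU',
      h.union (hγ.mdifferentiable one_ne_zero) hU hU'
        (hUc.ordConnected.inter hUc'.ordConnected).isPreconnected ⟨y, hyU, hyU'⟩ h'⟩

theorem exists_isParallelAlong (hγ : ContMDiff 𝓘(ℝ, ℝ) 𝓘(ℝ, E) 1 γ) (a : ℝ)
    (u : TangentSpace 𝓘(ℝ, E) (γ a)) :
    ∃ V : ∀ t, TangentSpace 𝓘(ℝ, E) (γ t), IsParallelAlong γ V ∧ V a = u := by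
  have hγ' := hγ.mdifferentiable one_ne_zero
  choose U hU hUc haU htU hsol using fun t ↦ exists_parallelSolvableOn (E := E) hγ a t
  choose V hVa hV using fun t ↦ hsol t a (haU t) u
  have heq : ∀ t, ∀ s ∈ U t, V s s = V t s := fun t s hs ↦
    eq_of_isParallelAt hγ' ((hU s).inter (hU t))
      ((hUc s).ordConnected.inter (hUc t).ordConnected).isPreconnected
      (fun r hr ↦ hV s r hr.1) (fun r hr ↦ hV t r hr.2) ⟨haU s, haU t⟩ ⟨htU s, hs⟩
      ((hVa s).trans (hVa t).symm)
  refine ⟨fun t ↦ V t t, fun t ↦ ?_, hVa a⟩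
  refine IsParallelAt.congr (hγ' t) (hV t t (htU t)) ?_
  filter_upwards [(hU t).mem_nhds (htU t)] with s hs
  exact heq t s hs

theorem IsParallelAlong.smul_add_smul (hγ : MDifferentiable 𝓘(ℝ, ℝ) 𝓘(ℝ, E) γ)
    (hV : IsParallelAlong γ V) (hW : IsParallelAlong γ W) (c d : ℝ) :
    IsParallelAlong γ (fun s ↦ c • V s + d • W s) :=
  fun t ↦ IsParallelAt.smul_add_smul (hγ t) (hV t) (hW t) c d

theorem IsParallelAlong.inner_eq (hγ : MDifferentiable 𝓘(ℝ, ℝ) 𝓘(ℝ, E) γ)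
    (hV : IsParallelAlong γ V) (hW : IsParallelAlong γ W) (a b : ℝ) :
    (inner ℝ (V a) (W a) : ℝ) = inner ℝ (V b) (W b) :=
  inner_eq_of_isParallelAt hγ isOpen_univ isPreconnected_univ (fun t _ ↦ hV t) (fun t _ ↦ hW t)
    (mem_univ a) (mem_univ b)

theorem IsParallelAlong.eq_of_eq (hγ : MDifferentiable 𝓘(ℝ, ℝ) 𝓘(ℝ, E) γ)
    (hV : IsParallelAlong γ V) (hW : IsParallelAlong γ W) (h : V a = W a) (b : ℝ) : V b = W b :=
  eq_of_isParallelAt hγ isOpen_univ isPreconnected_univ (fun t _ ↦ hV t) (fun t _ ↦ hW t)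
    (mem_univ a) (mem_univ b) h

theorem exists_linearIsometryEquiv_transport (hγ : ContMDiff 𝓘(ℝ, ℝ) 𝓘(ℝ, E) 1 γ) (a b : ℝ) :
    ∃ T : TangentSpace 𝓘(ℝ, E) (γ a) ≃ₗᵢ[ℝ] TangentSpace 𝓘(ℝ, E) (γ b),
      ∀ V : ∀ t, TangentSpace 𝓘(ℝ, E) (γ t), IsParallelAlong γ V → T (V a) = V b := by
  have hγ' := hγ.mdifferentiable one_ne_zero
  choose V hV hVa using fun u ↦ exists_isParallelAlong (E := E) hγ a u
  have heq : ∀ W : ∀ t, TangentSpace 𝓘(ℝ, E) (γ t), IsParallelAlong γ W →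
      V (W a) b = W b := fun W hW ↦ (hV (W a)).eq_of_eq hγ' hW (hVa (W a)) b
  have hlin : ∀ (c d : ℝ) (u w : TangentSpace 𝓘(ℝ, E) (γ a)),
      V (c • u + d • w) b = c • V u b + d • V w b := by
    intro c d u w
    simpa only [hVa] using heq _ ((hV u).smul_add_smul hγ' (hV w) c d)
  let T : TangentSpace 𝓘(ℝ, E) (γ a) →ₗ[ℝ] TangentSpace 𝓘(ℝ, E) (γ b) :=
    { toFun := fun u ↦ V u b
      map_add' := fun u w ↦ by simpa using hlin 1 1 u w
      map_smul' := fun c u ↦ by simpa using hlin c 0 u u }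
  have hinner : ∀ u w, (inner ℝ (T u) (T w) : ℝ) = inner ℝ u w := fun u w ↦ by
    have huw := (hV u).inner_eq hγ' (hV w) b a
    rw [hVa, hVa] at huw
    exact huw
  have hsurj : Function.Surjective (T.isometryOfInner hinner) := fun w ↦ by
    obtain ⟨W, hW, hWb⟩ := exists_isParallelAlong hγ b w
    exact ⟨W a, (heq W hW).trans hWb⟩
  exact ⟨LinearIsometryEquiv.ofSurjective _ hsurj, heq⟩

end ParallelTransport

section Geodesics

open Set Topology Filter

variable {E : Type*} [NormedAddCommGroup E] [NormedSpace ℝ E]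
  {M : Type*} [TopologicalSpace M] [ChartedSpace E M] {γ : ℝ → M}

theorem velocity_comp_mul (c t : ℝ) (hγ : MDifferentiableAt 𝓘(ℝ, ℝ) 𝓘(ℝ, E) γ (c * t)) :
    velocity (E := E) (fun s ↦ γ (c * s)) t = c • velocity (E := E) γ (c * t) := by
  have hc : HasFDerivAt (fun s : ℝ ↦ c * s) (c • ContinuousLinearMap.id ℝ ℝ) t :=
    (hasFDerivAt_id t).const_mul c
  have hcomp : velocity (E := E) (fun s ↦ γ (c * s)) t =
      mfderiv 𝓘(ℝ, ℝ) 𝓘(ℝ, E) γ (c * t) (c • (1 : ℝ)) :=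
    DFunLike.congr_fun (hγ.hasMFDerivAt.comp t hc.hasMFDerivAt).mfderiv (1 : ℝ)
  rw [hcomp]
  exact map_smul (mfderiv 𝓘(ℝ, ℝ) 𝓘(ℝ, E) γ (c * t)) c (1 : ℝ)

theorem contMDiff_comp_mul (hγ : ContMDiff 𝓘(ℝ, ℝ) 𝓘(ℝ, E) ∞ γ) (c : ℝ) :
    ContMDiff 𝓘(ℝ, ℝ) 𝓘(ℝ, E) ∞ (fun s ↦ γ (c * s)) :=
  hγ.comp (contDiff_const.mul contDiff_id).contMDiff

variable [RiemannianBundle (fun x : M ↦ TangentSpace 𝓘(ℝ, E) x)]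

theorem IsGeodesic.mdifferentiable [IsManifold 𝓘(ℝ, E) ∞ M] (hγ : IsGeodesic (E := E) γ) :
    MDifferentiable 𝓘(ℝ, ℝ) 𝓘(ℝ, E) γ :=
  hγ.1.mdifferentiable (by simp)

theorem GeodesicallyComplete.isGeodesicFrom_geodesic [IsManifold 𝓘(ℝ, E) ∞ M]
    (hM : GeodesicallyComplete E M) (x : M) (v : TangentSpace 𝓘(ℝ, E) x) :
    IsGeodesicFrom x v (geodesic x v) := by
  rw [geodesic, dif_pos (hM x v)]
  exact (hM x v).choose_spec

variable [FiniteDimensional ℝ E] {L : ℝ} {f : M → ℝ} {V : ∀ t, TangentSpace 𝓘(ℝ, E) (γ t)}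
  {x : M} {v : TangentSpace 𝓘(ℝ, E) x}

instance completeSpace_tangentSpace (x : M) : CompleteSpace (TangentSpace 𝓘(ℝ, E) x) :=
  have : FiniteDimensional ℝ (TangentSpace 𝓘(ℝ, E) x) := inferInstanceAs (FiniteDimensional ℝ E)
  FiniteDimensional.complete ℝ _

theorem inner_grad (f : M → ℝ) (x : M) (v : TangentSpace 𝓘(ℝ, E) x) :
    (inner ℝ (grad f x) v : ℝ) = mfderiv 𝓘(ℝ, E) 𝓘(ℝ, ℝ) f x v :=
  InnerProductSpace.toDual_symm_apply

theorem hasDerivAt_comp_inner_grad {t : ℝ} (hf : MDifferentiableAt 𝓘(ℝ, E) 𝓘(ℝ, ℝ) f (γ t))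
    (hγ : MDifferentiableAt 𝓘(ℝ, ℝ) 𝓘(ℝ, E) γ t) :
    HasDerivAt (fun s ↦ f (γ s)) (inner ℝ (grad f (γ t)) (velocity (E := E) γ t) : ℝ) t := by
  let A : ℝ →L[ℝ] ℝ := (mfderiv 𝓘(ℝ, E) 𝓘(ℝ, ℝ) f (γ t)).comp (mfderiv 𝓘(ℝ, ℝ) 𝓘(ℝ, E) γ t)
  have hcomp : HasFDerivAt (fun s ↦ f (γ s)) A t :=
    hasMFDerivAt_iff_hasFDerivAt.1 (hf.hasMFDerivAt.comp t hγ.hasMFDerivAt)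
  rw [inner_grad]
  exact hcomp.hasDerivAt

variable [IsManifold 𝓘(ℝ, E) ∞ M]

theorem GeodesicallySmooth.norm_sub_le (hf : GeodesicallySmooth E L f)
    (hγ : IsGeodesic (E := E) γ) (hV : IsParallelAlong γ V) (hV₁ : V 1 = grad f (γ 1)) :
    ‖grad f (γ 0) - V 0‖ ≤ L * ‖velocity (E := E) γ 0‖ :=
  hf.2 γ hγ (V 0) ⟨V, hV, by rw [hV₁], rfl⟩

variable [IsContMDiffRiemannianBundle 𝓘(ℝ, E) ∞ E (fun x : M ↦ TangentSpace 𝓘(ℝ, E) x)]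

theorem IsParallelAlong.comp_mul (hγ : MDifferentiable 𝓘(ℝ, ℝ) 𝓘(ℝ, E) γ)
    (hV : IsParallelAlong γ V) (c : ℝ) :
    IsParallelAlong (fun s ↦ γ (c * s)) (fun s ↦ V (c * s)) := by
  intro t
  have hγc : MDifferentiableAt 𝓘(ℝ, ℝ) 𝓘(ℝ, E) (fun s ↦ γ (c * s)) t :=
    (hγ (c * t)).comp t (differentiableAt_id.const_mul c).mdifferentiableAt
  exact (isParallelAt_iff_isParallelIn_self hγc).2
    ((isParallelAt_iff_isParallelIn_self (hγ (c * t))).1 (hV (c * t))).comp_mul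

theorem IsGeodesic.comp_mul (hγ : IsGeodesic (E := E) γ) (c : ℝ) :
    IsGeodesic (E := E) (fun s ↦ γ (c * s)) := by
  have hγc := contMDiff_comp_mul hγ.1 c
  have hvelocity := hγ.2.comp_mul hγ.mdifferentiable c
  refine ⟨hγc, ?_⟩
  convert hvelocity.smul_add_smul (hγc.mdifferentiable (by simp)) hvelocity c 0 using 2 with s
  rw [zero_smul, add_zero, velocity_comp_mul c s (hγ.mdifferentiable _)]

theorem IsGeodesic.exists_transport (hγ : IsGeodesic (E := E) γ) (a b : ℝ) :
    ∃ T : TangentSpace 𝓘(ℝ, E) (γ a) ≃ₗᵢ[ℝ] TangentSpace 𝓘(ℝ, E) (γ b),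
      ∀ V : ∀ t, TangentSpace 𝓘(ℝ, E) (γ t), IsParallelAlong γ V → T (V a) = V b :=
  exists_linearIsometryEquiv_transport (hγ.1.of_le (by simp)) a b

theorem IsGeodesic.exists_isParallelAlong (hγ : IsGeodesic (E := E) γ) (a : ℝ)
    (u : TangentSpace 𝓘(ℝ, E) (γ a)) :
    ∃ V : ∀ t, TangentSpace 𝓘(ℝ, E) (γ t), IsParallelAlong γ V ∧ V a = u :=
  RPage.exists_isParallelAlong (hγ.1.of_le (by simp)) a u

theorem GeodesicallySmooth.norm_sub_le_mul (hf : GeodesicallySmooth E L f)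
    (hγ : IsGeodesic (E := E) γ) (hV : IsParallelAlong γ V) {t : ℝ} (ht : 0 ≤ t)
    (hVt : V t = grad f (γ t)) :
    ‖grad f (γ 0) - V 0‖ ≤ L * (t * ‖velocity (E := E) γ 0‖) := by
  have h := hf.norm_sub_le (hγ.comp_mul t) (hV.comp_mul hγ.mdifferentiable t)
    (by rw [mul_one]; exact hVt)
  rw [velocity_comp_mul t 0 (hγ.mdifferentiable _), norm_smul, Real.norm_of_nonneg ht] at h
  rwa [mul_zero] at h

theorem GeodesicallySmooth.inner_grad_velocity_le (hf : GeodesicallySmooth E L f)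
    (hγ : IsGeodesic (E := E) γ) {t : ℝ} (ht : 0 ≤ t) :
    (inner ℝ (grad f (γ t)) (velocity (E := E) γ t) : ℝ) ≤
      inner ℝ (grad f (γ 0)) (velocity (E := E) γ 0) + L * ‖velocity (E := E) γ 0‖ ^ 2 * t := by
  obtain ⟨V, hV, hVt⟩ := hγ.exists_isParallelAlong t (grad f (γ t))
  have hdiff : (inner ℝ (V 0 - grad f (γ 0)) (velocity (E := E) γ 0) : ℝ) ≤
      L * (t * ‖velocity (E := E) γ 0‖) * ‖velocity (E := E) γ 0‖ := by
    refine (real_inner_le_norm _ _).trans ?_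
    rw [norm_sub_rev]
    gcongr
    exact hf.norm_sub_le_mul hγ hV ht hVt
  rw [← hVt, hV.inner_eq hγ.mdifferentiable hγ.2 t 0]
  rw [inner_sub_left] at hdiff
  linarith

theorem apply_one_le_of_hasDerivAt_le {φ φ' : ℝ → ℝ} {m c : ℝ} (hφ : ∀ t, HasDerivAt φ (φ' t) t)
    (hφ' : ∀ t, 0 ≤ t → φ' t ≤ m + c * t) : φ 1 ≤ φ 0 + m + c / 2 := by
  have hmodel : ∀ t : ℝ, HasDerivAt (fun s ↦ φ 0 + m * s + c / 2 * s ^ 2) (m + c * t) t := fun t ↦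
    ((((hasDerivAt_id' t).const_mul m).const_add (φ 0)).add
      ((hasDerivAt_pow 2 t).const_mul (c / 2))).congr_deriv (by ring)
  have hle := image_le_of_deriv_right_le_deriv_boundary (a := 0) (b := 1)
    (fun t _ ↦ (hφ t).continuousAt.continuousWithinAt) (fun t _ ↦ (hφ t).hasDerivWithinAt)
    (by simp) (fun t _ ↦ (hmodel t).continuousAt.continuousWithinAt)
    (fun t _ ↦ (hmodel t).hasDerivWithinAt) (fun t ht ↦ hφ' t ht.1)
    (right_mem_Icc.2 zero_le_one)
  linarith

theorem IsGeodesicFrom.apply_one_le (hγ : IsGeodesicFrom x v γ) (hf : GeodesicallySmooth E L f) :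
    f (γ 1) ≤ f x + inner ℝ (grad f x) v + L * ‖v‖ ^ 2 / 2 := by
  obtain ⟨hγ, heq⟩ := hγ
  obtain ⟨rfl, hv⟩ := TotalSpace.mk.inj heq
  obtain rfl := eq_of_heq hv
  exact apply_one_le_of_hasDerivAt_le
    (fun t ↦ hasDerivAt_comp_inner_grad (hf.1 (γ t)) (hγ.mdifferentiable t))
    (fun t ht ↦ hf.inner_grad_velocity_le hγ ht)

theorem IsGeodesicFrom.exists_transport (hγ : IsGeodesicFrom x v γ) :
    ∃ T : TangentSpace 𝓘(ℝ, E) x ≃ₗᵢ[ℝ] TangentSpace 𝓘(ℝ, E) (γ 1),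
      ∀ u w, IsParallelTransport γ 0 1 ⟨x, u⟩ ⟨γ 1, w⟩ ↔ w = T u := by
  obtain ⟨hγ, heq⟩ := hγ
  obtain ⟨rfl, -⟩ := TotalSpace.mk.inj heq
  obtain ⟨T, hT⟩ := hγ.exists_transport 0 1
  refine ⟨T, fun u w ↦ ⟨?_, ?_⟩⟩
  · rintro ⟨V, hV, h₀, h₁⟩
    rw [← TotalSpace.mk_injective (F := E) _ h₀, hT V hV, ← TotalSpace.mk_injective (F := E) _ h₁]
  · rintro rfl
    obtain ⟨V, hV, h₀⟩ := hγ.exists_isParallelAlong 0 u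
    exact ⟨V, hV, by rw [h₀], by rw [← hT V hV, h₀]⟩

theorem IsGeodesicFrom.norm_grad_sub_le (hγ : IsGeodesicFrom x v γ)
    (hf : GeodesicallySmooth E L f) {w : TangentSpace 𝓘(ℝ, E) (γ 1)}
    (hw : IsParallelTransport γ 0 1 ⟨x, grad f x⟩ ⟨γ 1, w⟩) : ‖grad f (γ 1) - w‖ ≤ L * ‖v‖ := by
  obtain ⟨hγ, heq⟩ := hγ
  obtain ⟨rfl, hv⟩ := TotalSpace.mk.inj heq
  obtain rfl := eq_of_heq hv
  obtain ⟨W, hW, hW₀, hW₁⟩ := hw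
  obtain ⟨T, hT⟩ := hγ.exists_transport 0 1
  obtain ⟨V, hV, hV₁⟩ := hγ.exists_isParallelAlong 1 (grad f (γ 1))
  have hle := hf.norm_sub_le hγ hV hV₁
  rwa [← TotalSpace.mk_injective (F := E) _ hW₁, ← hV₁, ← hT V hV, ← hT W hW,
    TotalSpace.mk_injective (F := E) _ hW₀, ← map_sub, LinearIsometryEquiv.norm_map, norm_sub_rev]

theorem GeodesicallyComplete.isParallelTransport_expTransport (hM : GeodesicallyComplete E M)
    (x : M) (v u : TangentSpace 𝓘(ℝ, E) x) : IsParallelTransport (geodesic x v) 0 1 ⟨x, u⟩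
      ⟨expMap x v, expTransport x v u⟩ := by
  obtain ⟨T, hT⟩ := (hM.isGeodesicFrom_geodesic x v).exists_transport
  have hex : ∃ w : TangentSpace 𝓘(ℝ, E) (expMap x v),
      IsParallelTransport (geodesic x v) 0 1 ⟨x, u⟩ ⟨expMap x v, w⟩ := ⟨T u, (hT u (T u)).2 rfl⟩
  rw [expTransport, dif_pos hex]
  exact hex.choose_spec

theorem GeodesicallyComplete.exists_expTransport_eq (hM : GeodesicallyComplete E M) (x : M)
    (v : TangentSpace 𝓘(ℝ, E) x) :
    ∃ T : TangentSpace 𝓘(ℝ, E) x ≃ₗᵢ[ℝ] TangentSpace 𝓘(ℝ, E) (expMap x v),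
      ∀ u, expTransport x v u = T u := by
  obtain ⟨T, hT⟩ := (hM.isGeodesicFrom_geodesic x v).exists_transport
  exact ⟨T, fun u ↦ (hT u _).1 (hM.isParallelTransport_expTransport x v u)⟩

theorem GeodesicallySmooth.norm_grad_expMap_sub_le (hf : GeodesicallySmooth E L f)
    (hM : GeodesicallyComplete E M) (x : M) (v : TangentSpace 𝓘(ℝ, E) x) :
    ‖grad f (expMap x v) - expTransport x v (grad f x)‖ ≤ L * ‖v‖ :=
  (hM.isGeodesicFrom_geodesic x v).norm_grad_sub_le hf (hM.isParallelTransport_expTransport x v _)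

theorem GeodesicallySmooth.apply_expMap_le (hf : GeodesicallySmooth E L f)
    (hM : GeodesicallyComplete E M) (x : M) (v : TangentSpace 𝓘(ℝ, E) x) :
    f (expMap x v) ≤ f x + inner ℝ (grad f x) v + L * ‖v‖ ^ 2 / 2 :=
  (hM.isGeodesicFrom_geodesic x v).apply_one_le hf

end Geodesics

section Objective

variable {E : Type*} [NormedAddCommGroup E] [NormedSpace ℝ E] [FiniteDimensional ℝ E]
  {M : Type*} [TopologicalSpace M] [ChartedSpace E M] [IsManifold 𝓘(ℝ, E) ∞ M]
  [RiemannianBundle (fun x : M ↦ TangentSpace 𝓘(ℝ, E) x)]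
  {Ξ : Type*} [MeasurableSpace Ξ]

variable (E) in
/-- The stochastic gradient at `x` is an unbiased estimator of the gradient of the objective. -/
def IsUnbiasedAt (D : Measure Ξ) (F : M → Ξ → ℝ) (x : M) : Prop :=
  Integrable (fun ξ ↦ (stochGrad F x ξ : TangentSpace 𝓘(ℝ, E) x)) D ∧
    ∫ ξ, (stochGrad F x ξ : TangentSpace 𝓘(ℝ, E) x) ∂D = grad (objective D F) x

theorem GeodesicallySmooth.objective
    [IsContMDiffRiemannianBundle 𝓘(ℝ, E) ∞ E (fun x : M ↦ TangentSpace 𝓘(ℝ, E) x)]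
    {D : Measure Ξ} [IsProbabilityMeasure D] {F : M → Ξ → ℝ} {L : ℝ}
    (hf : MDifferentiable 𝓘(ℝ, E) 𝓘(ℝ, ℝ) (objective D F)) (hunb : ∀ x, IsUnbiasedAt E D F x)
    (hF : ∀ ξ, GeodesicallySmooth E L (fun x ↦ F x ξ)) :
    GeodesicallySmooth E L (RPage.objective D F) := by
  refine ⟨hf, fun γ hγ w ⟨V, hV, hV₁, hV₀⟩ ↦ ?_⟩
  obtain ⟨T, hT⟩ := hγ.exists_transport 1 0
  have hint : Integrable (fun ξ ↦ T (stochGrad F (γ 1) ξ)) D :=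
    T.toContinuousLinearEquiv.toContinuousLinearMap.integrable_comp (hunb (γ 1)).1
  have hmean : ∫ ξ, T (stochGrad F (γ 1) ξ) ∂D = w := by
    rw [← TotalSpace.mk_injective (F := E) _ hV₀, ← hT V hV,
      TotalSpace.mk_injective (F := E) _ hV₁, ← (hunb (γ 1)).2]
    exact T.toContinuousLinearEquiv.integral_comp_comm _
  have hle : ∀ ξ, ‖stochGrad F (γ 0) ξ - T (stochGrad F (γ 1) ξ)‖
      ≤ L * ‖velocity (E := E) γ 0‖ := by
    intro ξ
    obtain ⟨W, hW, hW₁⟩ := hγ.exists_isParallelAlong 1 (stochGrad F (γ 1) ξ)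
    have hW₀ := (hF ξ).norm_sub_le hγ hW hW₁
    rwa [← hT W hW, hW₁] at hW₀
  rw [← hmean, ← (hunb (γ 0)).2, ← integral_sub (hunb (γ 0)).1 hint]
  simpa using norm_integral_le_of_norm_le_const (μ := D) (Filter.Eventually.of_forall hle)

end Objective

section Measurability

open Set Topology Filter

theorem measurable_of_countable_cover {X Y ι : Type*} [MeasurableSpace X] [MeasurableSpace Y]
    [Countable ι] {f : X → Y} {U : ι → Set X} (hU : ∀ i, MeasurableSet (U i))
    (hcover : ⋃ i, U i = univ) (hf : ∀ i, Measurable ((U i).domRestrict f)) : Measurable f := by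
  intro S hS
  have hpreimage : f ⁻¹' S = ⋃ i, Subtype.val '' ((U i).domRestrict f ⁻¹' S) := by
    simp_rw [domRestrict_eq, preimage_comp, Subtype.image_preimage_coe, ← iUnion_inter, hcover,
      univ_inter]
  rw [hpreimage]
  exact .iUnion fun i ↦ (hU i).subtype_image (hf i hS)

variable {E : Type*} [NormedAddCommGroup E] {M : Type*} [TopologicalSpace M] [ChartedSpace E M]

variable (E M) in
theorem exists_countable_chart_cover [SecondCountableTopology M] :
    ∃ I : Set M, I.Countable ∧ ⋃ z : I, (chartAt E z.1).source = univ := by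
  obtain ⟨I, hI, hcover⟩ := TopologicalSpace.countable_cover_nhds
    (fun z : M ↦ chart_source_mem_nhds E z)
  exact ⟨I, hI, by rwa [iUnion_subtype]⟩

variable [NormedSpace ℝ E] [IsManifold 𝓘(ℝ, E) ∞ M] {f : M → ℝ} {z q : M}

theorem mfderiv_eq_fderiv_toCoord (hf : MDifferentiableAt 𝓘(ℝ, E) 𝓘(ℝ, ℝ) f q)
    (hq : q ∈ (chartAt E z).source) (v : TangentSpace 𝓘(ℝ, E) q) :
    mfderiv 𝓘(ℝ, E) 𝓘(ℝ, ℝ) f q v =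
      fderiv ℝ (f ∘ (extChartAt 𝓘(ℝ, E) z).symm) (extChartAt 𝓘(ℝ, E) z q) (toCoord z q v) := by
  have hq' : q ∈ (extChartAt 𝓘(ℝ, E) z).source := by rwa [extChartAt_source]
  have hsymm : MDifferentiableAt 𝓘(ℝ, E) 𝓘(ℝ, E) (extChartAt 𝓘(ℝ, E) z).symm
      (extChartAt 𝓘(ℝ, E) z q) := by
    have := mdifferentiableWithinAt_extChartAt_symm (I := 𝓘(ℝ, E))
      ((extChartAt 𝓘(ℝ, E) z).map_source hq')
    rwa [𝓘(ℝ, E).range_eq_univ, mdifferentiableWithinAt_univ] at this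
  have hlocal : DifferentiableAt ℝ (f ∘ (extChartAt 𝓘(ℝ, E) z).symm) (extChartAt 𝓘(ℝ, E) z q) := by
    rw [← (extChartAt 𝓘(ℝ, E) z).left_inv hq'] at hf
    exact mdifferentiableAt_iff_differentiableAt.1 (hf.comp _ hsymm)
  have heq : (f ∘ (extChartAt 𝓘(ℝ, E) z).symm) ∘ extChartAt 𝓘(ℝ, E) z =ᶠ[𝓝 q] f := by
    filter_upwards [extChartAt_source_mem_nhds' hq'] with x hx
    rw [Function.comp_apply, Function.comp_apply, (extChartAt 𝓘(ℝ, E) z).left_inv hx]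
  have hcomp := hlocal.hasFDerivAt.hasMFDerivAt.comp q (hasMFDerivAt_extChartAt_toCoord hq)
  exact DFunLike.congr_fun (hcomp.congr_of_eventuallyEq heq.symm).mfderiv v

variable [RiemannianBundle (fun x : M ↦ TangentSpace 𝓘(ℝ, E) x)]

theorem norm_sq_eq_chartMetric (hq : q ∈ (chartAt E z).source) (v : TangentSpace 𝓘(ℝ, E) q) :
    ‖v‖ ^ 2 = chartMetric z (extChartAt 𝓘(ℝ, E) z q) (toCoord z q v) (toCoord z q v) := by
  rw [chartMetric_apply hq, ofCoord_toCoord hq, real_inner_self_eq_norm_sq]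

variable [FiniteDimensional ℝ E]

/-- The components in the preferred chart at `z` of the gradient of `f`, as a function on the model
space: the inverse of the metric applied to the differential. -/
def gradCoord (z : M) (f : M → ℝ) (y : E) : E :=
  (chartMetric z y).inverse (fderiv ℝ (f ∘ (extChartAt 𝓘(ℝ, E) z).symm) y)

theorem toCoord_grad (hf : MDifferentiableAt 𝓘(ℝ, E) 𝓘(ℝ, ℝ) f q)
    (hq : q ∈ (chartAt E z).source) :
    toCoord z q (grad f q) = gradCoord z f (extChartAt 𝓘(ℝ, E) z q) := by
  have hmetric : chartMetric z (extChartAt 𝓘(ℝ, E) z q) (toCoord z q (grad f q)) =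
      fderiv ℝ (f ∘ (extChartAt 𝓘(ℝ, E) z).symm) (extChartAt 𝓘(ℝ, E) z q) := by
    ext a
    rw [chartMetric_apply hq, ofCoord_toCoord hq, inner_grad, mfderiv_eq_fderiv_toCoord hf hq,
      toCoord_ofCoord hq]
  rw [gradCoord, ← hmetric, (isInvertible_chartMetric hq).inverse_apply_self]

variable [IsContMDiffRiemannianBundle 𝓘(ℝ, E) ∞ E (fun x : M ↦ TangentSpace 𝓘(ℝ, E) x)]

theorem measurable_domRestrict_gradCoord [MeasurableSpace E] [BorelSpace E] (z : M) (f : M → ℝ) :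
    Measurable ((extChartAt 𝓘(ℝ, E) z).target.domRestrict (gradCoord z f)) := by
  have hinv : ContinuousOn (fun y ↦ (chartMetric (E := E) z y).inverse)
      (extChartAt 𝓘(ℝ, E) z).target := by
    intro y hy
    have hq := (extChartAt 𝓘(ℝ, E) z).map_target hy
    rw [extChartAt_source] at hq
    have hinvertible : (chartMetric z y).IsInvertible := by
      rw [← (extChartAt 𝓘(ℝ, E) z).right_inv hy]
      exact isInvertible_chartMetric hq
    exact (hinvertible.contDiffAt_map_inverse (n := 0)).continuousAt.comp_continuousWithinAt
      ((contDiffOn_chartMetric z).continuousOn y hy)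
  exact ContinuousLinearMap.measurable_apply₂.comp
    (hinv.domRestrict.measurable.prodMk ((measurable_fderiv ℝ _).comp measurable_subtype_coe))

theorem measurable_norm_grad_sq [SecondCountableTopology M] [MeasurableSpace M] [BorelSpace M]
    (hf : MDifferentiable 𝓘(ℝ, E) 𝓘(ℝ, ℝ) f) :
    Measurable (fun x : M ↦ ‖grad (E := E) f x‖ ^ 2) := by
  borelize E
  obtain ⟨I, hI, hcover⟩ := exists_countable_chart_cover E M
  have : Countable I := hI
  refine measurable_of_countable_cover (fun z : I ↦ (chartAt E z.1).open_source.measurableSet)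
    hcover fun ⟨z, _⟩ ↦ ?_
  rw [← extChartAt_source 𝓘(ℝ, E)]
  let y : (extChartAt 𝓘(ℝ, E) z).source → (extChartAt 𝓘(ℝ, E) z).target :=
    (extChartAt 𝓘(ℝ, E) z).mapsTo.restrict
  have hy : Continuous y := (continuousOn_extChartAt z).mapsToRestrict _
  have hmetric : Continuous (fun q ↦ chartMetric (E := E) z (y q).1) :=
    ((contDiffOn_chartMetric z).continuousOn.domRestrict).comp hy
  have hgrad : Measurable (fun q ↦ gradCoord z f (y q).1) :=
    (measurable_domRestrict_gradCoord z f).comp hy.measurable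
  have hchart := ContinuousLinearMap.measurable_apply₂.comp
    ((ContinuousLinearMap.measurable_apply₂.comp (hmetric.measurable.prodMk hgrad)).prodMk hgrad)
  convert hchart using 1
  ext q
  have hq : q.1 ∈ (chartAt E z).source := extChartAt_source 𝓘(ℝ, E) z ▸ q.2
  rw [domRestrict_apply, norm_sq_eq_chartMetric hq, toCoord_grad (hf _) hq]
  rfl

end Measurability

section Variance

variable {Ξ H : Type*} {mΞ : MeasurableSpace Ξ} {μ : Measure Ξ} [NormedAddCommGroup H]
  [InnerProductSpace ℝ H]

theorem integrable_inner_of_memLp_two {X Y : Ξ → H} (hX : MemLp X 2 μ) (hY : MemLp Y 2 μ) :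
    Integrable (fun ξ ↦ (inner ℝ (X ξ) (Y ξ) : ℝ)) μ :=
  (L2.integrable_inner (𝕜 := ℝ) (hX.toLp X) (hY.toLp Y)).congr <| by
    filter_upwards [hX.coeFn_toLp, hY.coeFn_toLp] with ξ hXξ hYξ
    rw [hXξ, hYξ]

theorem integral_norm_add_sq {X Y : Ξ → H} (hX : MemLp X 2 μ) (hY : MemLp Y 2 μ)
    (hXY : ∫ ξ, (inner ℝ (X ξ) (Y ξ) : ℝ) ∂μ = 0) :
    ∫ ξ, ‖X ξ + Y ξ‖ ^ 2 ∂μ = ∫ ξ, ‖X ξ‖ ^ 2 ∂μ + ∫ ξ, ‖Y ξ‖ ^ 2 ∂μ := by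
  have hX2 : Integrable (fun ξ ↦ ‖X ξ‖ ^ 2) μ := hX.integrable_norm_pow two_ne_zero
  have hY2 : Integrable (fun ξ ↦ ‖Y ξ‖ ^ 2) μ := hY.integrable_norm_pow two_ne_zero
  have hinner := (integrable_inner_of_memLp_two hX hY).const_mul 2
  simp_rw [norm_add_sq_real]
  rw [integral_add (hX2.fun_add hinner) hY2, integral_add hX2 hinner, integral_const_mul, hXY,
    mul_zero, add_zero]

theorem integral_norm_sum_sq {ι : Type*} {X : ι → Ξ → H} (s : Finset ι)
    (hX : ∀ i, MemLp (X i) 2 μ)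
    (hXX : Pairwise fun i j ↦ ∫ ξ, (inner ℝ (X i ξ) (X j ξ) : ℝ) ∂μ = 0) :
    ∫ ξ, ‖∑ i ∈ s, X i ξ‖ ^ 2 ∂μ = ∑ i ∈ s, ∫ ξ, ‖X i ξ‖ ^ 2 ∂μ := by
  classical
  induction s using Finset.induction_on with
  | empty => simp
  | insert i s hi ih =>
    have horth : ∫ ξ, (inner ℝ (X i ξ) (∑ j ∈ s, X j ξ) : ℝ) ∂μ = 0 := by
      simp_rw [inner_sum]
      rw [integral_finsetSum _ fun j _ ↦ integrable_inner_of_memLp_two (hX i) (hX j)]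
      exact Finset.sum_eq_zero fun j hj ↦ hXX (ne_of_mem_of_not_mem hj hi).symm
    simp_rw [Finset.sum_insert hi]
    rw [integral_norm_add_sq (hX i) (memLp_finsetSum s fun j _ ↦ hX j) horth, ih]

variable [IsProbabilityMeasure μ] [CompleteSpace H]

theorem integral_inner_pi_eval {n : ℕ} {i j : Fin n} (hij : i ≠ j) {Z : Ξ → H}
    (hZ : Integrable Z μ) :
    ∫ ξ : Fin n → Ξ, (inner ℝ (Z (ξ i)) (Z (ξ j)) : ℝ) ∂(Measure.pi fun _ ↦ μ) =
      inner ℝ (∫ ξ, Z ξ ∂μ) (∫ ξ, Z ξ ∂μ) := by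
  have hindep : iIndepFun (fun (i : Fin n) (ξ : Fin n → Ξ) ↦ ξ i) (Measure.pi fun _ ↦ μ) :=
    iIndepFun_pi (X := fun _ ↦ id) fun _ ↦ aemeasurable_id
  have hZmap (i : Fin n) : Integrable Z ((Measure.pi fun _ ↦ μ).map fun ξ : Fin n → Ξ ↦ ξ i) :=
    (measurePreserving_eval (fun _ : Fin n ↦ μ) i).map_eq.symm ▸ hZ
  have hprod := (hindep.indepFun hij).integral_bilin_comp_comp
    (measurable_pi_apply i).aemeasurable (measurable_pi_apply j).aemeasurable
    (hZmap i) (hZmap j) (innerSL ℝ)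
  rwa [integral_comp_eval (μ := fun _ : Fin n ↦ μ) hZ.aestronglyMeasurable,
    integral_comp_eval (μ := fun _ : Fin n ↦ μ) hZ.aestronglyMeasurable] at hprod

theorem integral_norm_add_average_sq {n : ℕ} (hn : 0 < n) {Z : Ξ → H} (hZ : MemLp Z 2 μ)
    (hZ₀ : ∫ ξ, Z ξ ∂μ = 0) (a : H) :
    ∫ ξ : Fin n → Ξ, ‖a + (1 / n : ℝ) • ∑ i, Z (ξ i)‖ ^ 2 ∂(Measure.pi fun _ ↦ μ) =
      ‖a‖ ^ 2 + (∫ ξ, ‖Z ξ‖ ^ 2 ∂μ) / n := by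
  have hZint : Integrable Z μ := hZ.integrable one_le_two
  have hZeval (i : Fin n) : MemLp (fun ξ : Fin n → Ξ ↦ Z (ξ i)) 2 (Measure.pi fun _ ↦ μ) :=
    hZ.comp_measurePreserving (measurePreserving_eval (fun _ ↦ μ) i)
  have hsum : MemLp (fun ξ : Fin n → Ξ ↦ ∑ i, Z (ξ i)) 2 (Measure.pi fun _ ↦ μ) :=
    memLp_finsetSum _ fun i _ ↦ hZeval i
  have hsum₀ : ∫ ξ : Fin n → Ξ, ∑ i, Z (ξ i) ∂(Measure.pi fun _ ↦ μ) = 0 := by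
    rw [integral_finsetSum _ fun i _ ↦ (hZeval i).integrable one_le_two]
    simp only [integral_comp_eval (μ := fun _ ↦ μ) hZint.aestronglyMeasurable, hZ₀,
      Finset.sum_const_zero]
  have hsum_sq : ∫ ξ : Fin n → Ξ, ‖∑ i, Z (ξ i)‖ ^ 2 ∂(Measure.pi fun _ ↦ μ) =
      n * ∫ ξ, ‖Z ξ‖ ^ 2 ∂μ := by
    have horth : Pairwise fun i j : Fin n ↦
        ∫ ξ : Fin n → Ξ, (inner ℝ (Z (ξ i)) (Z (ξ j)) : ℝ) ∂(Measure.pi fun _ ↦ μ) = 0 :=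
      fun i j hij ↦ by simp only [integral_inner_pi_eval hij hZint, hZ₀, inner_zero_right]
    rw [integral_norm_sum_sq _ hZeval horth]
    simp only [integral_comp_eval (μ := fun _ ↦ μ) (f := fun ξ ↦ ‖Z ξ‖ ^ 2)
      (hZ.aestronglyMeasurable.norm.pow 2), Finset.sum_const, Finset.card_univ,
      Fintype.card_fin, nsmul_eq_mul]
  have hn' : (n : ℝ) ≠ 0 := by positivity
  have haverage : MemLp (fun ξ : Fin n → Ξ ↦ (1 / n : ℝ) • ∑ i, Z (ξ i)) 2
      (Measure.pi fun _ ↦ μ) := hsum.const_smul _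
  rw [integral_norm_add_sq (memLp_const a) haverage]
  · simp_rw [norm_smul, mul_pow]
    rw [integral_const_mul, hsum_sq, integral_const, probReal_univ, one_smul, Real.norm_eq_abs,
      sq_abs]
    field_simp
  · rw [integral_inner (haverage.integrable one_le_two), integral_smul, hsum₀,
      smul_zero, inner_zero_right]

theorem lintegral_norm_add_average_sub_sq_le {n : ℕ} (hn : 0 < n) {X : Ξ → H}
    (hX : MemLp X 2 μ) {v : ℝ} (hv : ∫ ξ, ‖X ξ - ∫ ζ, X ζ ∂μ‖ ^ 2 ∂μ ≤ v) (a : H) :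
    ∫⁻ ξ : Fin n → Ξ, ENNReal.ofReal (‖a + ((1 / n : ℝ) • ∑ i, X (ξ i) - ∫ ζ, X ζ ∂μ)‖ ^ 2)
      ∂(Measure.pi fun _ ↦ μ) ≤ ENNReal.ofReal (‖a‖ ^ 2 + v / n) := by
  set m := ∫ ξ, X ξ ∂μ
  have hZ : MemLp (fun ξ ↦ X ξ - m) 2 μ := hX.sub (memLp_const m)
  have hZ₀ : ∫ ξ, (X ξ - m) ∂μ = 0 := by
    simpa only [average_eq_integral] using integral_sub_average μ X
  have hcenter (ξ : Fin n → Ξ) :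
      (1 / n : ℝ) • ∑ i, X (ξ i) - m = (1 / n : ℝ) • ∑ i, (X (ξ i) - m) := by
    have hn' : (n : ℝ) ≠ 0 := by positivity
    rw [Finset.sum_sub_distrib, Finset.sum_const, Finset.card_univ, Fintype.card_fin, smul_sub,
      ← Nat.cast_smul_eq_nsmul ℝ, smul_smul, one_div_mul_cancel hn', one_smul]
  have haverage : MemLp (fun ξ : Fin n → Ξ ↦ a + (1 / n : ℝ) • ∑ i, (X (ξ i) - m)) 2
      (Measure.pi fun _ ↦ μ) :=
    (memLp_const a).add <| (memLp_finsetSum _ fun i _ ↦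
      hZ.comp_measurePreserving (measurePreserving_eval (fun _ ↦ μ) i)).const_smul _
  simp_rw [hcenter]
  rw [← ofReal_integral_eq_lintegral_ofReal (haverage.integrable_norm_pow two_ne_zero)
    (.of_forall fun _ ↦ sq_nonneg _), integral_norm_add_average_sq hn hZ hZ₀]
  gcongr

theorem integral_norm_sub_integral_sq_le {X : Ξ → H} (hX : MemLp X 2 μ) :
    ∫ ξ, ‖X ξ - ∫ ζ, X ζ ∂μ‖ ^ 2 ∂μ ≤ ∫ ξ, ‖X ξ‖ ^ 2 ∂μ := by
  set m := ∫ ξ, X ξ ∂μ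
  have hZ : MemLp (fun ξ ↦ X ξ - m) 2 μ := hX.sub (memLp_const m)
  have hcenter : ∫ ξ, (inner ℝ (X ξ - m) m : ℝ) ∂μ = 0 := by
    simp_rw [real_inner_comm m]
    have hZ₀ : ∫ ξ, (X ξ - m) ∂μ = 0 := by
      simpa only [average_eq_integral] using integral_sub_average μ X
    rw [integral_inner (hZ.integrable one_le_two), hZ₀, inner_zero_right]
  have hsplit := integral_norm_add_sq hZ (memLp_const m) hcenter
  simp only [sub_add_cancel] at hsplit
  rw [hsplit]
  exact le_add_of_nonneg_right (integral_nonneg fun _ ↦ sq_nonneg _)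

end Variance

section OneStep

variable {Ξ : Type*} [MeasurableSpace Ξ] {D : Measure Ξ} {B b : ℕ}
  {E : Type*} [NormedAddCommGroup E] [NormedSpace ℝ E] [FiniteDimensional ℝ E]
  {M : Type*} [TopologicalSpace M] [ChartedSpace E M]
  [RiemannianBundle (fun x : M ↦ TangentSpace 𝓘(ℝ, E) x)] {F : M → Ξ → ℝ}

variable (E) in
/-- The variance of the stochastic gradient at `x` is finite and at most `V`. -/
def HasVarianceLEAt (D : Measure Ξ) (F : M → Ξ → ℝ) (V : ℝ) (x : M) : Prop :=
  Integrable (fun ξ ↦ ‖(stochGrad F x ξ : TangentSpace 𝓘(ℝ, E) x) - grad (objective D F) x‖ ^ 2) D ∧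
    ∫ ξ, ‖(stochGrad F x ξ : TangentSpace 𝓘(ℝ, E) x) - grad (objective D F) x‖ ^ 2 ∂D ≤ V

theorem HasVarianceLEAt.nonneg {V : ℝ} {x : M} (hvar : HasVarianceLEAt E D F V x) : 0 ≤ V :=
  (integral_nonneg fun _ ↦ sq_nonneg _).trans hvar.2

theorem lintegral_bernoulliMeasure_ite (p : unitInterval) (a c : ENNReal) :
    ∫⁻ t : Bool, (if t then a else c) ∂(bernoulliMeasure true false p) =
      ENNReal.ofReal p * a + ENNReal.ofReal (1 - p) * c := by
  have hp : (unitInterval.toNNReal p : ENNReal) = ENNReal.ofReal p := by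
    rw [← unitInterval.coe_toNNReal p, ENNReal.ofReal_coe_nnreal]
  have hp' : (unitInterval.toNNReal (unitInterval.symm p) : ENNReal) = ENNReal.ofReal (1 - p) := by
    rw [← unitInterval.coe_symm_eq, ← unitInterval.coe_toNNReal (unitInterval.symm p),
      ENNReal.ofReal_coe_nnreal]
  rw [bernoulliMeasure_def, lintegral_add_measure]
  simp [lintegral_smul_measure, ENNReal.smul_def, hp, hp']

/-- The squared error of a state `(x, g)`, where `g` estimates the gradient of `f` at `x`. -/
def gradError (f : M → ℝ) (z : TangentBundle 𝓘(ℝ, E) M) : ℝ :=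
  ‖(z.2 : TangentSpace 𝓘(ℝ, E) z.1) - grad f z.1‖ ^ 2

theorem gradError_nonneg (f : M → ℝ) (z : TangentBundle 𝓘(ℝ, E) M) : 0 ≤ gradError f z :=
  sq_nonneg _

theorem pageStep_fst {Ξ : Type*} [IsManifold 𝓘(ℝ, E) ∞ M] {F : M → Ξ → ℝ} (η : ℝ)
    (z : TangentBundle 𝓘(ℝ, E) M) (s : Sample Ξ B b) :
    (pageStep F η z s).1 = expMap z.1 (-(η • z.2)) := by
  rcases s with ⟨ξ, ζ, _ | _⟩ <;> rfl

variable [IsProbabilityMeasure D]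

instance isProbabilityMeasure_sampleLaw (p : unitInterval) :
    IsProbabilityMeasure (sampleLaw D B b p) := by
  unfold sampleLaw
  infer_instance

theorem lintegral_sampleLaw_ite_le (p : unitInterval) (u : (Fin B → Ξ) → ENNReal)
    (v : (Fin b → Ξ) → ENNReal) :
    ∫⁻ s, (if s.2.2 then u s.1 else v s.2.1) ∂(sampleLaw D B b p) ≤
      ENNReal.ofReal p * ∫⁻ ξ, u ξ ∂(Measure.pi fun _ ↦ D)
        + ENNReal.ofReal (1 - p) * ∫⁻ ξ, v ξ ∂(Measure.pi fun _ ↦ D) :=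
  calc ∫⁻ s, (if s.2.2 then u s.1 else v s.2.1) ∂(sampleLaw D B b p)
    _ ≤ ∫⁻ ξ, ∫⁻ s, (if s.2 then u ξ else v s.1)
          ∂((Measure.pi fun _ : Fin b ↦ D).prod (bernoulliMeasure true false p))
          ∂(Measure.pi fun _ : Fin B ↦ D) := lintegral_prod_le _
    _ ≤ ∫⁻ ξ, ∫⁻ ζ, ∫⁻ t, (if t then u ξ else v ζ) ∂(bernoulliMeasure true false p)
          ∂(Measure.pi fun _ : Fin b ↦ D) ∂(Measure.pi fun _ : Fin B ↦ D) :=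
        lintegral_mono fun _ ↦ lintegral_prod_le _
    _ = _ := by
        simp only [lintegral_bernoulliMeasure_ite, lintegral_add_left measurable_const,
          lintegral_add_right _ measurable_const, lintegral_const_mul' _ _ ENNReal.ofReal_ne_top,
          lintegral_const, measure_univ, mul_one]

theorem IsUnbiasedAt.lintegral_norm_batchGrad_sub_sq_le {V : ℝ} {x : M}
    (hunb : IsUnbiasedAt E D F x) (hvar : HasVarianceLEAt E D F V x) (hB : 0 < B) :
    ∫⁻ ξ : Fin B → Ξ, ENNReal.ofReal
        (‖(batchGrad F ξ x : TangentSpace 𝓘(ℝ, E) x) - grad (objective D F) x‖ ^ 2)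
      ∂(Measure.pi fun _ ↦ D) ≤ ENNReal.ofReal (V / B) := by
  have hcenter : MemLp (fun ξ ↦ stochGrad F x ξ - grad (objective D F) x) 2 D :=
    (memLp_two_iff_integrable_sq_norm
      (hunb.1.aestronglyMeasurable.sub aestronglyMeasurable_const)).2 hvar.1
  have hX : MemLp (fun ξ ↦ (stochGrad F x ξ : TangentSpace 𝓘(ℝ, E) x)) 2 D := by
    refine (hcenter.add (memLp_const (grad (objective D F) x))).ae_eq (.of_forall fun ξ ↦ ?_)
    exact sub_add_cancel _ _
  have hbatch := lintegral_norm_add_average_sub_sq_le hB hX (hunb.2 ▸ hvar.2) 0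
  simpa only [batchGrad, hunb.2, zero_add, norm_zero, ne_eq, OfNat.ofNat_ne_zero,
    not_false_eq_true, zero_pow] using hbatch

variable [IsManifold 𝓘(ℝ, E) ∞ M]
  [IsContMDiffRiemannianBundle 𝓘(ℝ, E) ∞ E (fun x : M ↦ TangentSpace 𝓘(ℝ, E) x)] {L : ℝ}

theorem lintegral_norm_expTransport_add_batchGrad_sub_sq_le (hM : GeodesicallyComplete E M)
    (hunb : ∀ x, IsUnbiasedAt E D F x) (hF : ∀ ξ, GeodesicallySmooth E L (fun x ↦ F x ξ))
    (hb : 0 < b) (x : M) (v g : TangentSpace 𝓘(ℝ, E) x) :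
    ∫⁻ ξ : Fin b → Ξ, ENNReal.ofReal (‖expTransport x v g + batchGrad F ξ (expMap x v)
        - expTransport x v (batchGrad F ξ x) - grad (objective D F) (expMap x v)‖ ^ 2)
      ∂(Measure.pi fun _ ↦ D) ≤
      ENNReal.ofReal (‖g - grad (objective D F) x‖ ^ 2 + (L * ‖v‖) ^ 2 / b) := by
  set y := expMap x v
  obtain ⟨T, hT⟩ := hM.exists_expTransport_eq x v
  let X : Ξ → TangentSpace 𝓘(ℝ, E) y := fun ξ ↦ stochGrad F y ξ - T (stochGrad F x ξ)
  have hTint : Integrable (fun ξ ↦ T (stochGrad F x ξ)) D :=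
    T.toContinuousLinearEquiv.toContinuousLinearMap.integrable_comp (hunb x).1
  have hmean : ∫ ξ, X ξ ∂D = grad (objective D F) y - T (grad (objective D F) x) := by
    rw [integral_sub (hunb y).1 hTint, (hunb y).2, ← (hunb x).2]
    exact congrArg _ (T.toContinuousLinearEquiv.integral_comp_comm _)
  have hbound (ξ : Ξ) : ‖X ξ‖ ≤ L * ‖v‖ := by
    simpa only [X, hT, stochGrad] using (hF ξ).norm_grad_expMap_sub_le hM x v
  have hX : MemLp X 2 D :=
    .of_bound ((hunb y).1.sub hTint).aestronglyMeasurable _ (.of_forall hbound)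
  have hvar : ∫ ξ, ‖X ξ - ∫ ζ, X ζ ∂D‖ ^ 2 ∂D ≤ (L * ‖v‖) ^ 2 := by
    refine (integral_norm_sub_integral_sq_le hX).trans ?_
    have hmono : ∫ ξ, ‖X ξ‖ ^ 2 ∂D ≤ ∫ _, (L * ‖v‖) ^ 2 ∂D :=
      integral_mono (hX.integrable_norm_pow two_ne_zero) (integrable_const _) fun ξ ↦
        pow_le_pow_left₀ (norm_nonneg _) (hbound ξ) 2
    rwa [integral_const, probReal_univ, one_smul] at hmono
  have hbatch := lintegral_norm_add_average_sub_sq_le hb hX hvar (T (g - grad (objective D F) x))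
  rw [T.norm_map, hmean] at hbatch
  refine le_of_eq_of_le (lintegral_congr fun ξ ↦ ?_) hbatch
  congr 3
  simp only [hT, batchGrad, X, map_smul, map_sum, map_sub, Finset.sum_sub_distrib, smul_sub]
  abel

theorem lintegral_gradError_pageStep_le {V : ℝ} (hM : GeodesicallyComplete E M)
    (hunb : ∀ x, IsUnbiasedAt E D F x) (hvar : ∀ x, HasVarianceLEAt E D F V x)
    (hF : ∀ ξ, GeodesicallySmooth E L (fun x ↦ F x ξ)) (hB : 0 < B) (hb : 0 < b)
    (p : unitInterval) (η : ℝ) (z : TangentBundle 𝓘(ℝ, E) M) :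
    ∫⁻ s, ENNReal.ofReal (gradError (objective D F) (pageStep F η z s)) ∂(sampleLaw D B b p) ≤
      ENNReal.ofReal (p * (V / B) + (1 - p) * (gradError (objective D F) z
        + (L * η) ^ 2 * ‖(z.2 : TangentSpace 𝓘(ℝ, E) z.1)‖ ^ 2 / b)) := by
  let v : TangentSpace 𝓘(ℝ, E) z.1 := -(η • z.2)
  have hv : (L * ‖v‖) ^ 2 = (L * η) ^ 2 * ‖(z.2 : TangentSpace 𝓘(ℝ, E) z.1)‖ ^ 2 := by
    rw [norm_neg, norm_smul, ← mul_assoc, mul_pow, mul_pow L, Real.norm_eq_abs, sq_abs]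
    ring
  have hrefresh := (hunb (expMap z.1 v)).lintegral_norm_batchGrad_sub_sq_le (hvar _) hB
  have hrecursive :=
    lintegral_norm_expTransport_add_batchGrad_sub_sq_le hM hunb hF hb z.1 v z.2
  rw [hv] at hrecursive
  have hV : 0 ≤ V := (hvar z.1).nonneg
  have hp : 0 ≤ 1 - (p : ℝ) := unitInterval.one_minus_nonneg p
  have he : 0 ≤ gradError (objective D F) z := gradError_nonneg _ z
  rw [ENNReal.ofReal_add (mul_nonneg p.2.1 (by positivity)) (by positivity),
    ENNReal.ofReal_mul p.2.1, ENNReal.ofReal_mul hp]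
  refine le_trans (le_of_eq_of_le (lintegral_congr fun s ↦ ?_)
    (lintegral_sampleLaw_ite_le p _ _)) (add_le_add (mul_right_mono hrefresh)
      (mul_right_mono hrecursive))
  rcases s with ⟨ξ, ζ, _ | _⟩ <;> rfl

end OneStep

section Potential

/-- The potential of the convergence argument: `2 / η` times
`f(x) - f* + η / (2p) * ‖g - ∇f(x)‖²`, so that it decreases by `‖∇f(x)‖²` on average. -/
def pagePotential {E : Type*} [NormedAddCommGroup E] [NormedSpace ℝ E] [FiniteDimensional ℝ E]
    {M : Type*} [TopologicalSpace M] [ChartedSpace E M]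
    [RiemannianBundle (fun x : M ↦ TangentSpace 𝓘(ℝ, E) x)] (f : M → ℝ) (fstar η p : ℝ)
    (z : TangentBundle 𝓘(ℝ, E) M) : ℝ :=
  2 / η * (f z.1 - fstar) + gradError f z / p

theorem pageStepSize_bound {L η p : ℝ} {b : ℕ} (hL : 0 < L) (hη₀ : 0 < η) (hp₀ : 0 < p)
    (hp₁ : p ≤ 1) (hη : η ≤ 1 / (L * (1 + √((1 - p) / (p * b))))) :
    (1 - p) / (p * b) * (L * η) ^ 2 ≤ 1 - L * η := by
  set a := √((1 - p) / (p * b))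
  have ha : 0 ≤ a := Real.sqrt_nonneg _
  have ha_sq : (1 - p) / (p * b) = a ^ 2 :=
    (Real.sq_sqrt (div_nonneg (sub_nonneg.2 hp₁) (by positivity))).symm
  have hη' : η * (L * (1 + a)) ≤ 1 := (le_div_iff₀ (by positivity)).1 hη
  have hLη : 0 < L * η := mul_pos hL hη₀
  have haLη : a * (L * η) ≤ 1 - L * η := by linarith
  calc (1 - p) / (p * b) * (L * η) ^ 2 = (a * (L * η)) ^ 2 := by rw [ha_sq]; ring
    _ ≤ (1 - L * η) ^ 2 := by gcongr
    _ ≤ 1 - L * η := by nlinarith [mul_nonneg ha hLη.le]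

theorem sub_add_error_recursion_le {L η p e N W : ℝ} {b : ℕ} (hp : 0 < p)
    (hstep : (1 - p) / (p * b) * (L * η) ^ 2 ≤ 1 - L * η) (hN : 0 ≤ N) :
    e - (1 - L * η) * N + (p * W + (1 - p) * (e + (L * η) ^ 2 * N / b)) / p ≤ e / p + W := by
  calc e - (1 - L * η) * N + (p * W + (1 - p) * (e + (L * η) ^ 2 * N / b)) / p
    _ = e / p + W - (1 - L * η - (1 - p) / (p * b) * (L * η) ^ 2) * N := by
        linear_combination (W - e) * mul_inv_cancel₀ hp.ne'
    _ ≤ e / p + W := sub_le_self _ (mul_nonneg (sub_nonneg.2 hstep) hN)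

variable {E : Type*} [NormedAddCommGroup E] [NormedSpace ℝ E] [FiniteDimensional ℝ E]
  {M : Type*} [TopologicalSpace M] [ChartedSpace E M]
  [RiemannianBundle (fun x : M ↦ TangentSpace 𝓘(ℝ, E) x)] {f : M → ℝ} {L η fstar : ℝ}

theorem lintegral_pagePotential_le {X : Type*} [MeasurableSpace X] {ν : Measure X}
    [IsProbabilityMeasure ν] {p r : ℝ} (hη : 0 ≤ η) (hp : 0 ≤ p) {x : M} (hlow : fstar ≤ f x)
    {Z : X → TangentBundle 𝓘(ℝ, E) M} (hZ : ∀ s, (Z s).1 = x) (hr : 0 ≤ r)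
    (herror : ∫⁻ s, ENNReal.ofReal (gradError f (Z s)) ∂ν ≤ ENNReal.ofReal r) :
    ∫⁻ s, ENNReal.ofReal (pagePotential f fstar η p (Z s)) ∂ν ≤
      ENNReal.ofReal (2 / η * (f x - fstar) + r / p) := by
  have hp' : 0 ≤ p⁻¹ := inv_nonneg.2 hp
  have hgap : 0 ≤ 2 / η * (f x - fstar) := mul_nonneg (by positivity) (sub_nonneg.2 hlow)
  have hpotential (s : X) : ENNReal.ofReal (pagePotential f fstar η p (Z s)) =
      ENNReal.ofReal (2 / η * (f x - fstar))
        + ENNReal.ofReal p⁻¹ * ENNReal.ofReal (gradError f (Z s)) := by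
    rw [pagePotential, hZ, div_eq_inv_mul _ p, ENNReal.ofReal_add hgap
      (mul_nonneg hp' (gradError_nonneg f _)), ENNReal.ofReal_mul hp']
  simp only [hpotential]
  rw [lintegral_add_left measurable_const, lintegral_const, measure_univ, mul_one,
    lintegral_const_mul' _ _ ENNReal.ofReal_ne_top, div_eq_inv_mul r p,
    ENNReal.ofReal_add hgap (mul_nonneg hp' hr), ENNReal.ofReal_mul hp']
  gcongr

variable {Ξ : Type*} [MeasurableSpace Ξ] {D : Measure Ξ} [IsProbabilityMeasure D]
  {F : M → Ξ → ℝ} {B b : ℕ} {V : ℝ}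

theorem lintegral_pagePotential_batchGrad_le {x : M} (hunb : IsUnbiasedAt E D F x)
    (hvar : HasVarianceLEAt E D F V x) (hlow : fstar ≤ objective D F x) (hB : 0 < B)
    (p : unitInterval) (hη : 0 ≤ η) :
    ∫⁻ s, ENNReal.ofReal (pagePotential (objective D F) fstar η p
        (⟨x, batchGrad F s.1 x⟩ : TangentBundle 𝓘(ℝ, E) M)) ∂(sampleLaw D B b p) ≤
      ENNReal.ofReal (2 / η * (objective D F x - fstar) + V / B / p) := by
  have hV : 0 ≤ V := hvar.nonneg
  refine lintegral_pagePotential_le hη p.2.1 hlow (fun _ ↦ rfl) (by positivity) ?_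
  let e : (Fin B → Ξ) → ENNReal := fun ξ ↦ ENNReal.ofReal
    (‖(batchGrad F ξ x : TangentSpace 𝓘(ℝ, E) x) - grad (objective D F) x‖ ^ 2)
  calc ∫⁻ s, e s.1 ∂(sampleLaw D B b p)
    _ ≤ ∫⁻ ξ, ∫⁻ _, e ξ ∂((Measure.pi fun _ : Fin b ↦ D).prod (bernoulliMeasure true false p))
          ∂(Measure.pi fun _ ↦ D) := lintegral_prod_le _
    _ = ∫⁻ ξ, e ξ ∂(Measure.pi fun _ ↦ D) := by
        simp only [lintegral_const, measure_univ, mul_one]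
    _ ≤ ENNReal.ofReal (V / B) := hunb.lintegral_norm_batchGrad_sub_sq_le hvar hB

variable [IsManifold 𝓘(ℝ, E) ∞ M]
  [IsContMDiffRiemannianBundle 𝓘(ℝ, E) ∞ E (fun x : M ↦ TangentSpace 𝓘(ℝ, E) x)]

theorem GeodesicallySmooth.apply_expMap_neg_smul_le (hf : GeodesicallySmooth E L f)
    (hM : GeodesicallyComplete E M) (η : ℝ) (z : TangentBundle 𝓘(ℝ, E) M) :
    f (expMap z.1 (-(η • z.2))) ≤ f z.1 + η / 2 * (gradError f z
      - (1 - L * η) * ‖(z.2 : TangentSpace 𝓘(ℝ, E) z.1)‖ ^ 2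
      - ‖(grad f z.1 : TangentSpace 𝓘(ℝ, E) z.1)‖ ^ 2) := by
  have hdescent := hf.apply_expMap_le hM z.1 (-(η • z.2))
  rw [norm_neg, norm_smul, mul_pow, Real.norm_eq_abs, sq_abs, inner_neg_right,
    inner_smul_right] at hdescent
  rw [gradError, norm_sub_sq_real, real_inner_comm]
  linarith

theorem lintegral_pagePotential_pageStep_add_le (hM : GeodesicallyComplete E M)
    (hf : GeodesicallySmooth E L (objective D F))
    (hunb : ∀ x, IsUnbiasedAt E D F x) (hvar : ∀ x, HasVarianceLEAt E D F V x)
    (hF : ∀ ξ, GeodesicallySmooth E L (fun x ↦ F x ξ)) (hlow : ∀ x, fstar ≤ objective D F x)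
    (hB : 0 < B) (hb : 0 < b) {p : unitInterval} (hp : 0 < (p : ℝ)) (hη : 0 < η)
    (hstep : (1 - (p : ℝ)) / (p * b) * (L * η) ^ 2 ≤ 1 - L * η)
    (z : TangentBundle 𝓘(ℝ, E) M) :
    ∫⁻ s, ENNReal.ofReal (pagePotential (objective D F) fstar η p (pageStep F η z s))
        ∂(sampleLaw D B b p)
      + ENNReal.ofReal (‖(grad (objective D F) z.1 : TangentSpace 𝓘(ℝ, E) z.1)‖ ^ 2) ≤
      ENNReal.ofReal (pagePotential (objective D F) fstar η p z) + ENNReal.ofReal (V / B) := by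
  let N := ‖(z.2 : TangentSpace 𝓘(ℝ, E) z.1)‖ ^ 2
  let G := ‖(grad (objective D F) z.1 : TangentSpace 𝓘(ℝ, E) z.1)‖ ^ 2
  let e := gradError (objective D F) z
  let r := p * (V / B) + (1 - p) * (e + (L * η) ^ 2 * N / b)
  let y := expMap z.1 (-(η • z.2))
  have hN : 0 ≤ N := sq_nonneg _
  have hG : 0 ≤ G := sq_nonneg _
  have he : 0 ≤ e := gradError_nonneg _ _
  have hr : 0 ≤ r := by
    have hV : 0 ≤ V := (hvar z.1).nonneg
    have hp' : 0 ≤ 1 - (p : ℝ) := unitInterval.one_minus_nonneg p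
    positivity
  have hgap : 0 ≤ 2 / η * (objective D F y - fstar) :=
    mul_nonneg (by positivity) (sub_nonneg.2 (hlow y))
  have hdescent : 2 / η * (objective D F y - fstar) ≤
      2 / η * (objective D F z.1 - fstar) + (e - (1 - L * η) * N - G) :=
    calc 2 / η * (objective D F y - fstar)
      _ ≤ 2 / η * (objective D F z.1 + η / 2 * (e - (1 - L * η) * N - G) - fstar) :=
          mul_le_mul_of_nonneg_left (sub_le_sub_right (hf.apply_expMap_neg_smul_le hM η z) _)
            (by positivity)
      _ = _ := by field_simp; ring
  have hrecursion := sub_add_error_recursion_le (e := e) (W := V / B) hp hstep hN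
  calc _ ≤ ENNReal.ofReal (2 / η * (objective D F y - fstar) + r / p) + ENNReal.ofReal G := by
        gcongr
        exact lintegral_pagePotential_le hη.le hp.le (hlow y) (pageStep_fst η z) hr
          (lintegral_gradError_pageStep_le hM hunb hvar hF hB hb p η z)
    _ = ENNReal.ofReal (2 / η * (objective D F y - fstar) + r / p + G) :=
        (ENNReal.ofReal_add (by positivity) hG).symm
    _ ≤ ENNReal.ofReal (pagePotential (objective D F) fstar η p z + V / B) := by
        unfold pagePotential
        exact ENNReal.ofReal_le_ofReal (by linarith)
    _ ≤ _ := ENNReal.ofReal_add_le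

end Potential

section Resampling

variable {ι X : Type*} [DecidableEq ι]

theorem preimage_update_pi (s : Finset ι) (j : ι) (t : ι → Set X) :
    (fun q : (ι → X) × X ↦ Function.update q.1 j q.2) ⁻¹' (s : Set ι).pi t =
      ((s.erase j : Finset ι) : Set ι).pi t ×ˢ (if j ∈ s then t j else Set.univ) := by
  ext ⟨x, y⟩
  simp only [Set.mem_preimage, Set.mem_pi, Set.mem_prod, Finset.mem_coe, Finset.mem_erase]
  constructor
  · intro h
    refine ⟨fun i hi ↦ ?_, ?_⟩
    · simpa only [Function.update_of_ne hi.1] using h i hi.2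
    · split_ifs with hj
      · simpa only [Function.update_self] using h j hj
      · trivial
  · rintro ⟨hx, hy⟩ i hi
    obtain rfl | hij := eq_or_ne i j
    · rw [if_pos hi] at hy
      simpa only [Function.update_self] using hy
    · simpa only [Function.update_of_ne hij] using hx i ⟨hij, hi⟩

variable [MeasurableSpace X]

theorem measurable_update_prodMk (j : ι) :
    Measurable fun q : (ι → X) × X ↦ Function.update q.1 j q.2 := by
  refine measurable_pi_lambda _ fun i ↦ ?_
  obtain rfl | hij := eq_or_ne i j
  · simpa only [Function.update_self] using measurable_snd
  · simp only [Function.update_of_ne hij]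
    exact (measurable_pi_apply i).comp measurable_fst

theorem map_update_infinitePi_prod (ν : Measure X) [IsProbabilityMeasure ν] (j : ι) :
    ((Measure.infinitePi fun _ : ι ↦ ν).prod ν).map
      (fun q : (ι → X) × X ↦ Function.update q.1 j q.2) = Measure.infinitePi fun _ : ι ↦ ν := by
  refine Measure.eq_infinitePi _ fun s t ht ↦ ?_
  rw [Measure.map_apply (measurable_update_prodMk j)
    (MeasurableSet.pi s.countable_toSet fun i _ ↦ ht i), preimage_update_pi, Measure.prod_prod,
    Measure.infinitePi_pi _ fun i _ ↦ ht i]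
  split_ifs with hj
  · rw [Finset.prod_erase_mul s (fun i ↦ ν (t i)) hj]
  · rw [Finset.erase_eq_of_notMem hj, measure_univ, mul_one]

theorem lintegral_infinitePi_le_lintegral_update (ν : Measure X) [IsProbabilityMeasure ν] (j : ι)
    (f : (ι → X) → ENNReal) :
    ∫⁻ s, f s ∂(Measure.infinitePi fun _ ↦ ν) ≤
      ∫⁻ s, ∫⁻ x, f (Function.update s j x) ∂ν ∂(Measure.infinitePi fun _ ↦ ν) :=
  calc ∫⁻ s, f s ∂(Measure.infinitePi fun _ ↦ ν)
    _ = ∫⁻ s, f s ∂(((Measure.infinitePi fun _ : ι ↦ ν).prod ν).map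
          fun q ↦ Function.update q.1 j q.2) := by rw [map_update_infinitePi_prod]
    _ ≤ ∫⁻ q, f (Function.update q.1 j q.2) ∂((Measure.infinitePi fun _ : ι ↦ ν).prod ν) :=
        lintegral_map_le _ _
    _ ≤ _ := lintegral_prod_le _

end Resampling

section Iterates

theorem add_sum_range_le_of_add_le {a g : ℕ → ENNReal} {c : ENNReal}
    (h : ∀ k, a (k + 1) + g k ≤ a k + c) (K : ℕ) :
    a K + ∑ k ∈ Finset.range K, g k ≤ a 0 + K * c := by
  induction K with
  | zero => simp
  | succ K ih =>
    calc a (K + 1) + ∑ k ∈ Finset.range (K + 1), g k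
      _ = (a (K + 1) + g K) + ∑ k ∈ Finset.range K, g k := by
          rw [Finset.sum_range_succ, add_comm (∑ k ∈ _, g k), add_assoc]
      _ ≤ (a K + c) + ∑ k ∈ Finset.range K, g k := by gcongr ?_ + _; exact h K
      _ = (a K + ∑ k ∈ Finset.range K, g k) + c := add_right_comm _ _ _
      _ ≤ (a 0 + K * c) + c := by gcongr
      _ = a 0 + (K + 1 : ℕ) * c := by push_cast; ring

variable {E : Type*} [NormedAddCommGroup E] [NormedSpace ℝ E] [FiniteDimensional ℝ E]
  {M : Type*} [TopologicalSpace M] [ChartedSpace E M] [IsManifold 𝓘(ℝ, E) ∞ M]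
  [RiemannianBundle (fun x : M ↦ TangentSpace 𝓘(ℝ, E) x)]
  {Ξ : Type*} {F : M → Ξ → ℝ} {η : ℝ} {x₀ : M} {B b : ℕ}

theorem pageState_update_of_lt (s : ℕ → Sample Ξ B b) (s' : Sample Ξ B b) {j k : ℕ} (h : k < j) :
    pageState E F η x₀ (Function.update s j s') k = pageState E F η x₀ s k := by
  induction k with
  | zero => simp only [pageState, Function.update_of_ne h.ne]
  | succ k ih => simp only [pageState, Function.update_of_ne h.ne, ih (k.lt_succ_self.trans h)]

theorem pageState_update_succ (s : ℕ → Sample Ξ B b) (s' : Sample Ξ B b) (k : ℕ) :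
    pageState E F η x₀ (Function.update s (k + 1) s') (k + 1) =
      pageStep F η (pageState E F η x₀ s k) s' := by
  rw [pageState, pageState_update_of_lt s s' k.lt_succ_self, Function.update_self]

variable [MeasurableSpace Ξ] {D : Measure Ξ} [IsProbabilityMeasure D] {V L fstar : ℝ}

theorem lintegral_pagePotential_pageState_zero_le (hunb : IsUnbiasedAt E D F x₀)
    (hvar : HasVarianceLEAt E D F V x₀) (hlow : fstar ≤ objective D F x₀) (hB : 0 < B)
    (p : unitInterval) (hη : 0 ≤ η) :
    ∫⁻ s, ENNReal.ofReal (pagePotential (objective D F) fstar η p (pageState E F η x₀ s 0))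
        ∂(Measure.infinitePi fun _ ↦ sampleLaw D B b p) ≤
      ENNReal.ofReal (2 / η * (objective D F x₀ - fstar) + V / B / p) := by
  refine (lintegral_infinitePi_le_lintegral_update (sampleLaw D B b p) 0 _).trans ?_
  simp only [pageState, Function.update_self]
  rw [lintegral_const, measure_univ, mul_one]
  exact lintegral_pagePotential_batchGrad_le hunb hvar hlow hB p hη

variable [IsContMDiffRiemannianBundle 𝓘(ℝ, E) ∞ E (fun x : M ↦ TangentSpace 𝓘(ℝ, E) x)]

theorem lintegral_pagePotential_pageState_succ_add_le (hM : GeodesicallyComplete E M)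
    (hf : GeodesicallySmooth E L (objective D F))
    (hunb : ∀ x, IsUnbiasedAt E D F x) (hvar : ∀ x, HasVarianceLEAt E D F V x)
    (hF : ∀ ξ, GeodesicallySmooth E L (fun x ↦ F x ξ)) (hlow : ∀ x, fstar ≤ objective D F x)
    (hB : 0 < B) (hb : 0 < b) {p : unitInterval} (hp : 0 < (p : ℝ)) (hη : 0 < η)
    (hstep : (1 - (p : ℝ)) / (p * b) * (L * η) ^ 2 ≤ 1 - L * η) {k : ℕ}
    (hmeas : Measurable fun s : ℕ → Sample Ξ B b ↦
      ‖grad (E := E) (objective D F) (pageState E F η x₀ s k).1‖ ^ 2) :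
    ∫⁻ s, ENNReal.ofReal (pagePotential (objective D F) fstar η p
        (pageState E F η x₀ s (k + 1))) ∂(Measure.infinitePi fun _ ↦ sampleLaw D B b p)
      + ∫⁻ s, ENNReal.ofReal (‖grad (E := E) (objective D F) (pageState E F η x₀ s k).1‖ ^ 2)
        ∂(Measure.infinitePi fun _ ↦ sampleLaw D B b p) ≤
      ∫⁻ s, ENNReal.ofReal (pagePotential (objective D F) fstar η p (pageState E F η x₀ s k))
        ∂(Measure.infinitePi fun _ ↦ sampleLaw D B b p) + ENNReal.ofReal (V / B) := by
  let μ : Measure (ℕ → Sample Ξ B b) := Measure.infinitePi fun _ ↦ sampleLaw D B b p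
  let Φ : TangentBundle 𝓘(ℝ, E) M → ENNReal := fun z ↦
    ENNReal.ofReal (pagePotential (objective D F) fstar η p z)
  let G : (ℕ → Sample Ξ B b) → ENNReal := fun s ↦
    ENNReal.ofReal (‖grad (E := E) (objective D F) (pageState E F η x₀ s k).1‖ ^ 2)
  calc ∫⁻ s, Φ (pageState E F η x₀ s (k + 1)) ∂μ + ∫⁻ s, G s ∂μ
    _ ≤ ∫⁻ s, ∫⁻ s', Φ (pageState E F η x₀ (Function.update s (k + 1) s') (k + 1))
          ∂(sampleLaw D B b p) ∂μ + ∫⁻ s, G s ∂μ := by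
        gcongr ?_ + _
        exact lintegral_infinitePi_le_lintegral_update (sampleLaw D B b p) (k + 1) _
    _ = ∫⁻ s, (∫⁻ s', Φ (pageStep F η (pageState E F η x₀ s k) s') ∂(sampleLaw D B b p)
          + G s) ∂μ := by
        simp only [pageState_update_succ]
        exact (lintegral_add_right _ hmeas.ennreal_ofReal).symm
    _ ≤ ∫⁻ s, (Φ (pageState E F η x₀ s k) + ENNReal.ofReal (V / B)) ∂μ :=
        lintegral_mono fun s ↦ lintegral_pagePotential_pageStep_add_le hM hf hunb hvar hF hlow
          hB hb hp hη hstep _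
    _ = _ := by rw [lintegral_add_right _ measurable_const, lintegral_const, measure_univ, mul_one]

theorem sum_lintegral_norm_grad_sq_le (hM : GeodesicallyComplete E M)
    (hf : GeodesicallySmooth E L (objective D F))
    (hunb : ∀ x, IsUnbiasedAt E D F x) (hvar : ∀ x, HasVarianceLEAt E D F V x)
    (hF : ∀ ξ, GeodesicallySmooth E L (fun x ↦ F x ξ)) (hlow : ∀ x, fstar ≤ objective D F x)
    (hB : 0 < B) (hb : 0 < b) {p : unitInterval} (hp : 0 < (p : ℝ)) (hη : 0 < η)
    (hstep : (1 - (p : ℝ)) / (p * b) * (L * η) ^ 2 ≤ 1 - L * η)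
    (hmeas : ∀ k, Measurable fun s : ℕ → Sample Ξ B b ↦
      ‖grad (E := E) (objective D F) (pageState E F η x₀ s k).1‖ ^ 2) (K : ℕ) :
    ∑ k ∈ Finset.range K, ∫⁻ s, ENNReal.ofReal
        (‖grad (E := E) (objective D F) (pageState E F η x₀ s k).1‖ ^ 2)
        ∂(Measure.infinitePi fun _ ↦ sampleLaw D B b p) ≤
      ENNReal.ofReal (2 / η * (objective D F x₀ - fstar) + V / B / p + K * (V / B)) := by
  have hV : 0 ≤ V := (hvar x₀).nonneg
  have hgap : 0 ≤ 2 / η * (objective D F x₀ - fstar) :=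
    mul_nonneg (by positivity) (sub_nonneg.2 (hlow x₀))
  let a : ℕ → ENNReal := fun k ↦ ∫⁻ s, ENNReal.ofReal
    (pagePotential (objective D F) fstar η p (pageState E F η x₀ s k))
    ∂(Measure.infinitePi fun _ ↦ sampleLaw D B b p)
  have hsum := add_sum_range_le_of_add_le (a := a) (fun k ↦
    lintegral_pagePotential_pageState_succ_add_le hM hf hunb hvar hF hlow hB hb hp hη hstep
      (hmeas k)) K
  refine le_add_self.trans (hsum.trans ?_)
  rw [ENNReal.ofReal_add (by positivity) (by positivity), ENNReal.ofReal_mul K.cast_nonneg,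
    ENNReal.ofReal_natCast]
  gcongr
  exact lintegral_pagePotential_pageState_zero_le (hunb x₀) (hvar x₀) (hlow x₀) hB p hη.le

end Iterates

section Measurability

variable {E : Type*} [NormedAddCommGroup E] [NormedSpace ℝ E] [FiniteDimensional ℝ E]
  {M : Type*} [TopologicalSpace M] [SecondCountableTopology M] [ChartedSpace E M]
  [IsManifold 𝓘(ℝ, E) ∞ M] [RiemannianBundle (fun x : M ↦ TangentSpace 𝓘(ℝ, E) x)]
  [IsContMDiffRiemannianBundle 𝓘(ℝ, E) ∞ E (fun x : M ↦ TangentSpace 𝓘(ℝ, E) x)]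

theorem measurable_norm_grad_sq_comp {X : Type*} [MeasurableSpace X] {f : M → ℝ}
    (hf : MDifferentiable 𝓘(ℝ, E) 𝓘(ℝ, ℝ) f) {Z : X → TangentBundle 𝓘(ℝ, E) M}
    (hZ : Measurable[_, borel (TangentBundle 𝓘(ℝ, E) M)] Z) :
    Measurable fun s ↦ ‖grad (E := E) f (Z s).1‖ ^ 2 := by
  borelize M (TangentBundle 𝓘(ℝ, E) M)
  exact (measurable_norm_grad_sq hf).comp
    ((FiberBundle.continuous_proj E (TangentSpace 𝓘(ℝ, E))).measurable.comp hZ)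

end Measurability

section Transfer

variable {X Ω : Type*} [MeasurableSpace X] [MeasurableSpace Ω] {P : Measure Ω}

theorem integrable_and_integral_le_of_lintegral_ofReal_le {f : Ω → ℝ} {c : ℝ}
    (hfm : AEStronglyMeasurable f P) (hf : ∀ a, 0 ≤ f a) (hc : 0 ≤ c)
    (h : ∫⁻ a, ENNReal.ofReal (f a) ∂P ≤ ENNReal.ofReal c) :
    Integrable f P ∧ ∫ a, f a ∂P ≤ c := by
  refine ⟨(lintegral_ofReal_ne_top_iff_integrable hfm (.of_forall hf)).1
    (ne_top_of_le_ne_top ENNReal.ofReal_ne_top h), ?_⟩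
  rw [integral_eq_lintegral_of_nonneg_ae (.of_forall hf) hfm]
  exact ENNReal.toReal_le_of_le_ofReal hc h

theorem aemeasurable_comp_index {K : ℕ} {Y : Type*} [MeasurableSpace Y] {g : ℕ → X → Y}
    (hg : ∀ k, Measurable (g k)) {κ : Ω → Fin K} (hκ : AEMeasurable κ P) {S : Ω → X}
    (hS : AEMeasurable S P) : AEMeasurable (fun a ↦ g (κ a) (S a)) P :=
  (measurable_from_prod_countable_right (f := fun q : Fin K × X ↦ g q.1 q.2)
    fun i ↦ hg i).comp_aemeasurable (hκ.prodMk hS)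

theorem lintegral_comp_uniform_index [IsProbabilityMeasure P] {μ : Measure X}
    [IsProbabilityMeasure μ] {K : ℕ} {g : ℕ → X → ENNReal} (hg : ∀ k, Measurable (g k))
    {κ : Ω → Fin K} {S : Ω → X} (hκ : HasLaw κ (uniformOn Set.univ) P) (hS : HasLaw S μ P)
    (hind : IndepFun κ S P) :
    ∫⁻ a, g (κ a) (S a) ∂P = (∑ k ∈ Finset.range K, ∫⁻ s, g k s ∂μ) / K := by
  have hpair : P.map (fun a ↦ (κ a, S a)) = (uniformOn Set.univ).prod μ := by
    rw [(indepFun_iff_map_prod_eq_prod_map_map hκ.aemeasurable hS.aemeasurable).1 hind,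
      hκ.map_eq, hS.map_eq]
  have hmeas : Measurable fun q : Fin K × X ↦ g q.1 q.2 :=
    measurable_from_prod_countable_right fun i ↦ hg i
  calc ∫⁻ a, g (κ a) (S a) ∂P
    _ = ∫⁻ q, g q.1 q.2 ∂(P.map fun a ↦ (κ a, S a)) :=
        (lintegral_map' hmeas.aemeasurable (hκ.aemeasurable.prodMk hS.aemeasurable)).symm
    _ = ∫⁻ i : Fin K, ∫⁻ s, g i s ∂μ ∂(uniformOn Set.univ) := by
        rw [hpair, lintegral_prod _ hmeas.aemeasurable]
    _ = (∑ k ∈ Finset.range K, ∫⁻ s, g k s ∂μ) / K := by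
        rw [lintegral_fintype, Finset.sum_range, div_eq_mul_inv, Finset.sum_mul]
        simp [uniformOn_univ]

end Transfer

end RPage

end

theorem theorem4_general
    {E : Type*} [NormedAddCommGroup E] [NormedSpace ℝ E] [FiniteDimensional ℝ E]
    {M : Type*} [TopologicalSpace M] [SecondCountableTopology M]
    [ChartedSpace E M] [IsManifold 𝓘(ℝ, E) ∞ M]
    [RiemannianBundle (fun x : M ↦ TangentSpace 𝓘(ℝ, E) x)]
    [IsContMDiffRiemannianBundle 𝓘(ℝ, E) ∞ E (fun x : M ↦ TangentSpace 𝓘(ℝ, E) x)]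
    (hM : RPage.GeodesicallyComplete E M)
    {Ξ : Type*} [MeasurableSpace Ξ] (D : Measure Ξ) [IsProbabilityMeasure D]
    (F : M → Ξ → ℝ) (_hF : ∀ x, Integrable (F x) D)
    (hf : MDifferentiable 𝓘(ℝ, E) 𝓘(ℝ, ℝ) (RPage.objective D F))
    (hunb : ∀ x, RPage.IsUnbiasedAt E D F x)
    (σ : ℝ) (hvar : ∀ x, RPage.HasVarianceLEAt E D F (σ ^ 2) x)
    (L : ℝ) (hsmooth : ∀ ξ, RPage.GeodesicallySmooth E L (fun x ↦ F x ξ))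
    (fstar : ℝ) (hlow : ∀ x, fstar ≤ RPage.objective D F x)
    (x₀ : M) (B b K : ℕ) (hB : 0 < B) (hb : 0 < b) (hK : 0 < K)
    (p : ℝ) (hp₀ : 0 < p) (hp₁ : p ≤ 1)
    (η : ℝ) (hη₀ : 0 < η) (hη : (1 - p) / (p * b) * (L * η) ^ 2 ≤ 1 - L * η)
    (hmeas : ∀ k, Measurable[_, borel (TangentBundle 𝓘(ℝ, E) M)]
      (fun s : ℕ → RPage.Sample Ξ B b ↦ RPage.pageState E F η x₀ s k))
    {Ω : Type*} [MeasurableSpace Ω] (P : Measure Ω) [IsProbabilityMeasure P]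
    (S : ℕ → Ω → RPage.Sample Ξ B b)
    (hS : ∀ k, HasLaw (S k) (RPage.sampleLaw D B b ⟨p, hp₀.le, hp₁⟩) P) (hSind : iIndepFun S P)
    (κ : Ω → Fin K) (hκ : HasLaw κ (uniformOn Set.univ) P)
    (hκind : IndepFun κ (fun a k ↦ S k a) P) :
    let xhat : Ω → M := fun a ↦ (RPage.pageState E F η x₀ (fun k ↦ S k a) (κ a)).1
    let gradSq : Ω → ℝ := fun a ↦
      ‖(RPage.grad (RPage.objective D F) (xhat a) : TangentSpace 𝓘(ℝ, E) (xhat a))‖ ^ 2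
    let Φ₀ : ℝ := RPage.objective D F x₀ - fstar + η * σ ^ 2 / (2 * p * B)
    Integrable gradSq P ∧ ∫ a, gradSq a ∂P ≤ 2 * Φ₀ / (η * K) + σ ^ 2 / B := by
  intro xhat gradSq Φ₀
  have hgrad (k : ℕ) := RPage.measurable_norm_grad_sq_comp hf (hmeas k)
  have hlaw := hSind.hasLaw_infinitePi hS (aemeasurable_pi_lambda _ fun k ↦ (hS k).aemeasurable)
  have hgap : 0 ≤ RPage.objective D F x₀ - fstar := sub_nonneg.2 (hlow x₀)
  refine RPage.integrable_and_integral_le_of_lintegral_ofReal_le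
    (RPage.aemeasurable_comp_index hgrad hκ.aemeasurable hlaw.aemeasurable).aestronglyMeasurable
    (fun a ↦ sq_nonneg _) (by positivity) ?_
  calc ∫⁻ a, ENNReal.ofReal (gradSq a) ∂P
    _ = (∑ k ∈ Finset.range K, ∫⁻ s, ENNReal.ofReal
          (‖RPage.grad (E := E) (RPage.objective D F) (RPage.pageState E F η x₀ s k).1‖ ^ 2)
          ∂(Measure.infinitePi fun _ ↦ RPage.sampleLaw D B b ⟨p, hp₀.le, hp₁⟩)) / K :=
        RPage.lintegral_comp_uniform_index (fun k ↦ (hgrad k).ennreal_ofReal) hκ hlaw hκind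
    _ ≤ ENNReal.ofReal (2 / η * (RPage.objective D F x₀ - fstar) + σ ^ 2 / B / p
          + K * (σ ^ 2 / B)) / K := by
        gcongr
        exact RPage.sum_lintegral_norm_grad_sq_le hM
          (RPage.GeodesicallySmooth.objective hf hunb hsmooth) hunb hvar hsmooth hlow hB hb
          hp₀ hη₀ hη hgrad K
    _ = ENNReal.ofReal (2 * Φ₀ / (η * K) + σ ^ 2 / B) := by
        rw [← ENNReal.ofReal_natCast K, ← ENNReal.ofReal_div_of_pos (by positivity)]
        congr 1
        simp only [Φ₀]
        field_simp

theorem theorem4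
    -- a complete Riemannian manifold
    {E : Type*} [NormedAddCommGroup E] [NormedSpace ℝ E] [FiniteDimensional ℝ E]
    {M : Type*} [TopologicalSpace M] [T2Space M] [SecondCountableTopology M]
    [ChartedSpace E M] [IsManifold 𝓘(ℝ, E) ∞ M]
    [RiemannianBundle (fun x : M ↦ TangentSpace 𝓘(ℝ, E) x)]
    [IsContMDiffRiemannianBundle 𝓘(ℝ, E) ∞ E (fun x : M ↦ TangentSpace 𝓘(ℝ, E) x)]
    (hM : RPage.GeodesicallyComplete E M)
    -- the online problem
    {Ξ : Type*} [MeasurableSpace Ξ] (D : Measure Ξ) [IsProbabilityMeasure D]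
    (F : M → Ξ → ℝ) (hF : ∀ x, Integrable (F x) D)
    (hf : MDifferentiable 𝓘(ℝ, E) 𝓘(ℝ, ℝ) (RPage.objective D F))
    -- unbiasedness and bounded variance
    (hunb : ∀ x : M, Integrable (fun ξ ↦ (RPage.stochGrad F x ξ : TangentSpace 𝓘(ℝ, E) x)) D ∧
      ∫ ξ, (RPage.stochGrad F x ξ : TangentSpace 𝓘(ℝ, E) x) ∂D
        = RPage.grad (RPage.objective D F) x)
    (σ : ℝ) (hσ : 0 ≤ σ)
    (hvar : ∀ x : M,
      Integrable (fun ξ ↦ ‖(RPage.stochGrad F x ξ : TangentSpace 𝓘(ℝ, E) x)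
        - RPage.grad (RPage.objective D F) x‖ ^ 2) D ∧
      ∫ ξ, ‖(RPage.stochGrad F x ξ : TangentSpace 𝓘(ℝ, E) x)
        - RPage.grad (RPage.objective D F) x‖ ^ 2 ∂D ≤ σ ^ 2)
    -- geodesic smoothness and lower bound
    (L : ℝ) (hL : 0 < L) (hsmooth : ∀ ξ, RPage.GeodesicallySmooth E L (fun x ↦ F x ξ))
    (fstar : ℝ) (hlow : ∀ x, fstar ≤ RPage.objective D F x)
    -- parameters of the method
    (x₀ : M) (B b K : ℕ) (hB : 0 < B) (hb : 0 < b) (hK : 0 < K)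
    (p : ℝ) (hp₀ : 0 < p) (hp₁ : p ≤ 1)
    (η : ℝ) (hη₀ : 0 < η) (hη : η ≤ 1 / (L * (1 + √((1 - p) / (p * b)))))
    -- the iterates are random variables
    (hmeas : ∀ k, Measurable[_, borel (TangentBundle 𝓘(ℝ, E) M)]
      (fun s : ℕ → RPage.Sample Ξ B b ↦ RPage.pageState E F η x₀ s k))
    -- independent samples, and a uniform output index independent of them
    {Ω : Type*} [MeasurableSpace Ω] (P : Measure Ω) [IsProbabilityMeasure P]
    (S : ℕ → Ω → RPage.Sample Ξ B b)
    (hS : ∀ k, HasLaw (S k) (RPage.sampleLaw D B b ⟨p, hp₀.le, hp₁⟩) P) (hSind : iIndepFun S P)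
    (κ : Ω → Fin K) (hκ : HasLaw κ (uniformOn Set.univ) P)
    (hκind : IndepFun κ (fun a k ↦ S k a) P) :
    let xhat : Ω → M := fun a ↦ (RPage.pageState E F η x₀ (fun k ↦ S k a) (κ a)).1
    let gradSq : Ω → ℝ := fun a ↦
      ‖(RPage.grad (RPage.objective D F) (xhat a) : TangentSpace 𝓘(ℝ, E) (xhat a))‖ ^ 2
    let Φ₀ : ℝ := RPage.objective D F x₀ - fstar + η * σ ^ 2 / (2 * p * B)
    Integrable gradSq P ∧ ∫ a, gradSq a ∂P ≤ 2 * Φ₀ / (η * K) + σ ^ 2 / B := by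
  exact theorem4_general hM D F hF hf hunb σ hvar L hsmooth fstar hlow x₀ B b K hB hb hK p hp₀ hp₁
    η hη₀ (RPage.pageStepSize_bound hL hη₀ hp₀ hp₁ hη) hmeas P S hS hSind κ hκ hκind
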